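/- **Setting.** Fix $a,b>1$ and $c_1,c_2,c_3>0$. Let $\xi$ be random with $H(\xi)\in\mathbb R^{d\times d}$ symmetric positive semidefinite and $b(\xi)\in\mathbb R^d$ integrable; put $F(w,\xi)=\tfrac12 w^\top H(\xi)w-b(\xi)^\top w$, $f(w)=\mathbb E F(w,\xi)$, and let $H=\mathbb E H(\xi)=\sum_{i=1}^d\lambda_i v_iv_i^\top$ with $\lambda_1\ge\dots\ge\lambda_d$ and $(v_i)$ orthonormal, $d\ge1$. Let $w_*$ be the minimizer of $f$ and $w^{(i)}=v_i^\top w$. Assume $c_1 i^{-a}\le\lambda_i\le c_2 i^{-a}$ and $\lambda_i (w_*^{(i)})^2\le c_3 i^{-b}$ for $i=1,\dots,d$. **Algorithm (SHB).** For an integer $T\ge16$ let $n=\lfloor\log_2T\rfloor$ and $K=\lfloor T/n\rfloor$. From $w_0=u_0=0$ and i.i.d. copies $\xi_0,\xi_1,\dots$ of $\xi$, run $u_{t+1}=\beta u_t+\eta_t\nabla F(w_t,\xi_t)$, $w_{t+1}=w_t-u_{t+1}$ with $\eta_t=\eta_0/4^{\ell-1}$ for $K(\ell-1)\le t\le K\ell-1$,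 $1\le\ell\le n$; the output is $\hat w_T=w_{nK}$ (so $nK=T$ when $T=2^n$ and $n\mid T$). Let $\zeta_t=\nabla F(w_t,\xi_t)-\nabla f(w_t)$ and assume, for some $\sigma\ge0$, that $\zeta_t$ is square integrable and $\mathbb E[\zeta_t\zeta_t^\top\mid w_t]\preceq\sigma^2H$ for every $t<nK$. **Claim.** There are constants $C,c>0$ depending only on $a,b,c_1,c_2,c_3$ (not on $d$, $T$, $\sigma$ or the problem) such that: 1. If $b<a\le 2b$, put $A=256\log_2T\cdot\ln T$, and let $T$ be such that $A\,T^{-(a-b)/b}\le1$. Then SHB with $\beta=(1-A\,T^{-(a-b)/b})^2$ and $\eta_0=(2\lambda_1)^{-1}$ satisfies $$\mathbb E f(\hat w_T)-\inf f\le C\Big((\log_2T)^6\,T^{-1+1/b}+\sigma^2(\log_2T)^8\,T^{-1+1/b}\Big).$$ 2. If $a\le b$, then vanilla SGD ($\beta=0$) with $\eta_0=\frac1{2\lambda_1}T^{-1+a/b}$ satisfies $$\mathbb E f(\hat w_T)-\inf f\le C\Big((\log_2T)^{2(b-1)/a}\,T^{-1+1/b}+\sigma^2(\log_2T)^4\,T^{-1+1/b}\Big).$$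 3. (Matching lower bound.) Fix any eigensystem $(\lambda_i,v_i)_{i\le d}$ as above with $c_1i^{-a}\le\lambda_i\le c_2i^{-a}$, and let $\sigma>0$, $T\ge1$ be an integer with $T\ge\sigma^2$, and $d\ge(T/\sigma^2)^{1/b}$. Let $\mathcal F$ be the class of problems with $\mathbb E H(\xi)=H$, $\lambda_i(w_*^{(i)})^2\le c_3i^{-b}$ for all $i$, and $\operatorname{Cov}(\nabla F(w,\xi))\preceq\sigma^2H$ for all $w$. Then $$\inf_{\mathcal A}\ \sup_{\mathcal F}\ \big(\mathbb E f(\hat w_T)-\inf f\big)\ \ge\ c\,T^{-1+1/b}\sigma^{2-2/b},$$ where the infimum is over all, possibly randomized, algorithms computing each estimate $\hat w_t$, $t\le T$, as a measurable function of the observations $(H(\xi_i),b(\xi_i))_{i<t}$, the previous estimates, the initial point and randomness independent of the data. In particular, for constant $\sigma^2>0$ the rates in 1 and 2 match the minimax rate $T^{-1+1/b}$ up to powers of $\log T$. -/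

import Mathlib

open MeasureTheory ProbabilityTheory Matrix

noncomputable section

namespace HeavyBall

/-- Vectors of `ℝ^d`. Only the dot product `⬝ᵥ` is used on them, no norm. -/
abbrev Vec (d : ℕ) : Type := Fin d → ℝ

/-- Matrices carry the product `σ`-algebra of their entries. -/
instance instMeasurableSpaceMatrix (d : ℕ) : MeasurableSpace (Matrix (Fin d) (Fin d) ℝ) :=
  inferInstanceAs (MeasurableSpace (Fin d → Fin d → ℝ))

/-- One observation `(H(ξ), b(ξ))`. -/
abbrev Obs (d : ℕ) : Type := Matrix (Fin d) (Fin d) ℝ × Vec d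

/-- The individual function `F(w, ξ) = ½ wᵀ H(ξ) w - b(ξ)ᵀ w`. -/
def sampleLoss {d : ℕ} (w : Vec d) (z : Obs d) : ℝ :=
  (1 / 2) * (w ⬝ᵥ (z.1 *ᵥ w)) - z.2 ⬝ᵥ w

/-- The stochastic gradient `∇_w F(w, ξ) = H(ξ) w - b(ξ)`. -/
def sampleGrad {d : ℕ} (w : Vec d) (z : Obs d) : Vec d :=
  z.1 *ᵥ w - z.2

/-- A stochastic quadratic problem: the law of the observation `(H(ξ), b(ξ))`, with `H(ξ)`
symmetric positive semidefinite and integrable entries. -/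
structure Problem (d : ℕ) where
  law : Measure (Obs d)
  [prob : IsProbabilityMeasure law]
  posSemidef : ∀ᵐ z ∂law, z.1.PosSemidef
  integrable_H : ∀ i j, Integrable (fun z : Obs d => z.1 i j) law
  integrable_b : ∀ i, Integrable (fun z : Obs d => z.2 i) law

namespace Problem

variable {d : ℕ} (P : Problem d)

/-- The objective `f(w) = 𝔼_ξ F(w, ξ)`. -/
def objective (w : Vec d) : ℝ := ∫ z, sampleLoss w z ∂P.law

/-- The Hessian `H = 𝔼 H(ξ)` of the objective. -/
def hessian : Matrix (Fin d) (Fin d) ℝ := Matrix.of fun i j => ∫ z, z.1 i j ∂P.law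

/-- The linear term `b = 𝔼 b(ξ)` of the objective. -/
def linearTerm : Vec d := fun i => ∫ z, z.2 i ∂P.law

/-- The gradient `∇f(w) = H w - b`. -/
def grad (w : Vec d) : Vec d := P.hessian *ᵥ w - P.linearTerm

/-- The gradient noise `∇F(w, ξ) - ∇f(w)`. -/
def gradNoise (w : Vec d) (z : Obs d) : Vec d := sampleGrad w z - P.grad w

/-- The excess risk `f(w) - inf f`. -/
def excessRisk (w : Vec d) : ℝ := P.objective w - ⨅ w', P.objective w'

/-- `lam` and the columns of the orthogonal matrix `V` are the eigenvalues, in descending order, and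
the eigenvectors of the Hessian: `H = V diag(lam) Vᵀ`. -/
structure IsEigensystem (V : Matrix (Fin d) (Fin d) ℝ) (lam : Fin d → ℝ) : Prop where
  orthogonal : V ∈ Matrix.orthogonalGroup (Fin d) ℝ
  hessian_eq : P.hessian = V * Matrix.diagonal lam * Vᵀ
  antitone : Antitone lam

/-- The source condition `λ_i (w_*^{(i)})² ≤ c₃ i^{-b}` for `i = 1, …, d`, where `w_*` minimizes
the objective and `w^{(i)} = v_iᵀ w`. The index `i : Fin d` stands for `i + 1`. -/
def SourceCondition (V : Matrix (Fin d) (Fin d) ℝ) (lam : Fin d → ℝ) (b c₃ : ℝ) : Prop :=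
  ∃ wstar : Vec d, (∀ w, P.objective wstar ≤ P.objective w) ∧
    ∀ i : Fin d, lam i * ((Vᵀ *ᵥ wstar) i) ^ 2 ≤ c₃ * ((i : ℝ) + 1) ^ (-b)

/-- The gradient noise at every point has covariance at most `σ² H` in the Loewner order. -/
def NoiseBoundedBy (σ : ℝ) : Prop :=
  ∀ w : Vec d, MemLp (P.gradNoise w) 2 P.law ∧
    ∀ v : Vec d, ∫ z, (v ⬝ᵥ P.gradNoise w z) ^ 2 ∂P.law ≤ σ ^ 2 * (v ⬝ᵥ (P.hessian *ᵥ v))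

end Problem

/-- Power-law spectrum `c₁ i^{-a} ≤ λ_i ≤ c₂ i^{-a}` for `i = 1, …, d`. -/
def PowerLawSpectrum {d : ℕ} (lam : Fin d → ℝ) (a c₁ c₂ : ℝ) : Prop :=
  ∀ i : Fin d, c₁ * ((i : ℝ) + 1) ^ (-a) ≤ lam i ∧ lam i ≤ c₂ * ((i : ℝ) + 1) ^ (-a)

/-! ### The algorithm -/

/-- Number of stages, `log₂ T` (rounded down). -/
def numStages (T : ℕ) : ℕ := Nat.log 2 T

/-- Number of iterations in each stage, `T / log₂ T` (rounded down). -/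
def stageLength (T : ℕ) : ℕ := T / numStages T

/-- Total number of iterations performed (equal to `T` when no rounding takes place). -/
def totalSteps (T : ℕ) : ℕ := numStages T * stageLength T

/-- The step size `η₀ / 4^{ℓ-1}` in stage `ℓ`, that is for `K (ℓ-1) ≤ t ≤ K ℓ - 1`, with `K` the
stage length. -/
def stepSize (η₀ : ℝ) (T t : ℕ) : ℝ := η₀ / 4 ^ (t / stageLength T)

/-- The pair `(w_t, u_t)` of the stochastic heavy ball method run on the observations `z`, from
`w₀ = u₀ = 0`: `u_{t+1} = β u_t + η_t ∇F(w_t, z_t)` and `w_{t+1} = w_t - u_{t+1}`. -/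
def shbState {d : ℕ} (β η₀ : ℝ) (T : ℕ) (z : ℕ → Obs d) : ℕ → Vec d × Vec d
  | 0 => (0, 0)
  | t + 1 =>
    let s := shbState β η₀ T z t
    let u := β • s.2 + stepSize η₀ T t • sampleGrad s.1 (z t)
    (s.1 - u, u)

/-- The iterate `w_t`. -/
def shbIterate {d : ℕ} (β η₀ : ℝ) (T : ℕ) (z : ℕ → Obs d) (t : ℕ) : Vec d :=
  (shbState β η₀ T z t).1

/-- The output of the algorithm, its last iterate. -/
def shbOutput {d : ℕ} (β η₀ : ℝ) (T : ℕ) (z : ℕ → Obs d) : Vec d :=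
  shbIterate β η₀ T z (totalSteps T)

/-- The constant `A = 256 log₂ T ln T`. -/
def momentumConst (T : ℕ) : ℝ := 256 * Real.logb 2 T * Real.log T

section Sampling

variable {d : ℕ} {Ω : Type*} [MeasurableSpace Ω]

/-- The observations `ξ 0, ξ 1, …` are independent with the law of the problem. -/
structure IsSample (P : Problem d) (μ : Measure Ω) (ξ : ℕ → Ω → Obs d) : Prop where
  measurable : ∀ t, Measurable (ξ t)
  map_eq : ∀ t, μ.map (ξ t) = P.law
  indep : iIndepFun ξ μ

/-- The gradient noise `ζ_t` met by the algorithm at its iterate `w_t`. -/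
def runNoise (P : Problem d) (ξ : ℕ → Ω → Obs d) (β η₀ : ℝ) (T t : ℕ) (ω : Ω) : Vec d :=
  P.gradNoise (shbIterate β η₀ T (fun s => ξ s ω) t) (ξ t ω)

/-- The anisotropic noise assumption along the run of the algorithm: at every iteration the noise
is square integrable and `𝔼[ζ_t ζ_tᵀ | w_t] ⪯ σ² H`, the Loewner order being tested on all
vectors `v`. (That `𝔼[ζ_t | w_t] = 0` follows from the independence of the observations.) -/
def RunNoiseBoundedBy (P : Problem d) (μ : Measure Ω) (ξ : ℕ → Ω → Obs d) (β η₀ : ℝ) (T : ℕ)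
    (σ : ℝ) : Prop :=
  ∀ t < totalSteps T, MemLp (runNoise P ξ β η₀ T t) 2 μ ∧
    ∀ v : Vec d,
      μ[fun ω => (v ⬝ᵥ runNoise P ξ β η₀ T t ω) ^ 2 |
        MeasurableSpace.comap (fun ω => shbIterate β η₀ T (fun s => ξ s ω) t) inferInstance]
      ≤ᵐ[μ] fun _ => σ ^ 2 * (v ⬝ᵥ (P.hessian *ᵥ v))

/-- The expected excess risk of the output of the algorithm is finite and at most `B`. -/
def ExpectedExcessLE (P : Problem d) (μ : Measure Ω) (ξ : ℕ → Ω → Obs d) (β η₀ : ℝ) (T : ℕ)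
    (B : ℝ) : Prop :=
  Integrable (fun ω => P.objective (shbOutput β η₀ T (fun s => ξ s ω))) μ ∧
    (∫ ω, P.objective (shbOutput β η₀ T (fun s => ξ s ω)) ∂μ) - (⨅ w, P.objective w) ≤ B

end Sampling

/-! ### Minimax risk over all estimation procedures -/

/-- A possibly randomized algorithm: from the private random seed, the observations of the first
`t` rounds and the previous estimates `ŵ_0, …, ŵ_{t-1}` (with `ŵ_0 = w₀`), it computes `ŵ_t`. The
seed may contain fresh randomness for every round. -/
structure Algorithm (d : ℕ) where
  Seed : Type
  [mSeed : MeasurableSpace Seed]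
  seedLaw : Measure Seed
  [seedProb : IsProbabilityMeasure seedLaw]
  init : Vec d
  step : (t : ℕ) → Seed × (Fin t → Obs d) × (Fin t → Vec d) → Vec d
  measurable_step : ∀ t, Measurable (step t)

attribute [instance] Problem.prob Algorithm.mSeed Algorithm.seedProb

/-- The estimate `ŵ_t` for `t ≤ T`, from the seed `s` and the data `z` of `T` rounds. -/
def Algorithm.estimate {d T : ℕ} (𝒜 : Algorithm d) (s : 𝒜.Seed) (z : Fin T → Obs d) :
    (t : ℕ) → t ≤ T → Vec d
  | 0, _ => 𝒜.init
  | t + 1, h =>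
    𝒜.step (t + 1) (s, fun i => z (Fin.castLE h i),
      fun i : Fin (t + 1) => 𝒜.estimate s z i.1 (le_trans (le_of_lt i.2) h))
  termination_by t => t
  decreasing_by exact i.isLt

/-- The expected excess risk of the estimate `ŵ_T` computed from `T` independent observations, over
the data and the seed. -/
def Algorithm.risk {d : ℕ} (𝒜 : Algorithm d) (P : Problem d) (T : ℕ) : ENNReal :=
  ∫⁻ p : 𝒜.Seed × (Fin T → Obs d), ENNReal.ofReal (P.excessRisk (𝒜.estimate p.1 p.2 T le_rfl))
    ∂(𝒜.seedLaw.prod (Measure.pi fun _ : Fin T => P.law))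

/-- The minimax expected excess risk of all algorithms with `T` observations, over the problems of
the class `𝓕`. -/
def minimaxRisk {d : ℕ} (𝓕 : Set (Problem d)) (T : ℕ) : ENNReal :=
  ⨅ 𝒜 : Algorithm d, ⨆ P ∈ 𝓕, 𝒜.risk P T

/-- The problems whose Hessian has the eigensystem `(V, lam)`, with the source condition and
gradient noise of covariance at most `σ² H`. -/
def sourceClass {d : ℕ} (V : Matrix (Fin d) (Fin d) ℝ) (lam : Fin d → ℝ) (b c₃ σ : ℝ) :
    Set (Problem d) :=
  {P | P.IsEigensystem V lam ∧ P.SourceCondition V lam b c₃ ∧ P.NoiseBoundedBy σ}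

end HeavyBall

end

noncomputable section

namespace HeavyBall

/-! ### The heavy ball recursion in one eigendirection -/

/-! Upper bounds. The Hessian is fixed, so in each eigendirection the error obeys a scalar linear
recursion driven by centered noises that are pairwise uncorrelated. Duhamel's formula (`hb_duhamel`,
`shbState_coord`) and orthogonality bound the expected excess risk by a bias sum and a variance sum
over eigendirections (`expectedExcessLE_of_flow`). What remains is the scalar heavy ball operator
with momentum `(1 - δ)²` and rate `q = ηλ ≤ 1/2`. For `q ≤ δ²` its characteristic roots are real,
and a Lyapunov function contracts by `1 - q/(4δ)` per step: momentum multiplies the effective step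
size by `1/δ`. For `q > δ²` the roots are complex of modulus `1 - δ`, and one stage kills the
direction because `Kδ ≥ 128 log T`. Plain SGD is the case `δ = 1`, where only the first regime
occurs.

Let `s = Kλ₁η₀/δ`, which is `T^(a/b)` up to logarithms. Up to a term of size `1/T`, the bias in
direction `i` is damped by `exp(-sλᵢ/(2λ₁))`. Directions with `i ≲ T^(1/b)` are therefore learned,
and the rest leave about `∑_{i > T^(1/b)} i^(-b) ≈ T^(-1+1/b)`. The variance of a direction is at
most of order `min(1, (sλᵢ/λ₁)²)/K` per stage (`StageRegime.variance_sum_le`): noise of a stage is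
damped by the next one, whose step size is only four times smaller, and in the last stage the step
size is already negligible. So about `T^(1/b)` directions contribute `1/K` each. Both claims follow
from `exists_shb_excess_le`. If `a ≤ b`, a step size below `1/(2λ₁)` reaches this `s`; if `b < a`,
momentum supplies the missing factor.

Lower bound. With deterministic Hessian and a linear term made of random signs of mean `eᵢ` in the
eigenbasis, the excess risk is half the squared error of estimating the vector `σe`. Taking `eᵢ =
±ε` with `ε² ≈ 1/T` on the first `(T/σ²)^(1/b)` coordinates respects the source condition, while `T`
samples cannot determine the signs. Assouad's argument (`assouad_sum_le`) sums the losses over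
coordinates. -/

/-- One noiseless heavy ball step for the scalar quadratic with step size times curvature `q`,
acting on the pair (position, velocity). -/
def hbStep (β q : ℝ) : (ℝ × ℝ) →ₗ[ℝ] (ℝ × ℝ) where
  toFun x := (x.1 - (β * x.2 + q * x.1), β * x.2 + q * x.1)
  map_add' x y := by ext <;> simp <;> ring
  map_smul' c x := by ext <;> simp <;> ring

@[simp] lemma hbStep_fst (β q : ℝ) (x : ℝ × ℝ) :
    (hbStep β q x).1 = x.1 - (β * x.2 + q * x.1) := rfl

@[simp] lemma hbStep_snd (β q : ℝ) (x : ℝ × ℝ) : (hbStep β q x).2 = β * x.2 + q * x.1 := rfl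

/-- The noiseless flow started at time `s`, after `k` steps. -/
def hbFlow (β : ℝ) (q : ℕ → ℝ) (s : ℕ) (x : ℝ × ℝ) : ℕ → ℝ × ℝ
  | 0 => x
  | k + 1 => hbStep β (q (s + k)) (hbFlow β q s x k)

lemma hbFlow_add (β : ℝ) (q : ℕ → ℝ) (s : ℕ) (x : ℝ × ℝ) (k l : ℕ) :
    hbFlow β q s x (k + l) = hbFlow β q (s + k) (hbFlow β q s x k) l := by
  induction l with
  | zero => rfl
  | succ l ih => rw [← add_assoc, hbFlow, hbFlow, ih, add_assoc]

/-- Duhamel's formula for the heavy ball recursion with an additive perturbation. -/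
lemma hb_duhamel (β : ℝ) (q e : ℕ → ℝ) (S : ℕ → ℝ × ℝ) (N : ℕ)
    (h : ∀ t < N, S (t + 1) = hbStep β (q t) (S t) + e t • ((-1, 1) : ℝ × ℝ)) :
    S N = hbFlow β q 0 (S 0) N
      + ∑ s ∈ Finset.range N, e s • hbFlow β q (s + 1) (-1, 1) (N - (s + 1)) := by
  induction N with
  | zero => simp [hbFlow]
  | succ N ih =>
    rw [h N (Nat.lt_succ_self N), ih fun t ht => h t (ht.trans (Nat.lt_succ_self N)),
      Finset.sum_range_succ, map_add, map_sum, hbFlow, zero_add, add_assoc]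
    congr 2
    · refine Finset.sum_congr rfl fun s hs => ?_
      have hs := Finset.mem_range.1 hs
      have h1 : N + 1 - (s + 1) = (N - (s + 1)) + 1 := by omega
      rw [h1, hbFlow, map_smul]
      congr 4
      omega
    · simp [hbFlow]

/-! ### Real roots: a Lyapunov function independent of the step size -/

/-- Lyapunov function of the heavy ball recursion with momentum `(1 - δ) ^ 2`. -/
def hbLyap (δ : ℝ) (x : ℝ × ℝ) : ℝ :=
  max |(1 - (1 - δ) ^ 2) * x.1 - (1 - δ) ^ 2 * x.2| (2 * |(1 - δ) ^ 2 * x.2|)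

lemma hbLyap_nonneg (δ : ℝ) (x : ℝ × ℝ) : 0 ≤ hbLyap δ x :=
  (abs_nonneg _).trans (le_max_left _ _)

/-- The two quantities inside the maximum recombine to `(1 - β) * x.1`, and `1 - β ≥ δ`. -/
lemma abs_fst_le_hbLyap {δ : ℝ} (h0 : 0 < δ) (h1 : δ ≤ 1) (x : ℝ × ℝ) :
    |x.1| ≤ 3 / (2 * δ) * hbLyap δ x := by
  have hz : |(1 - (1 - δ) ^ 2) * x.1 - (1 - δ) ^ 2 * x.2| ≤ hbLyap δ x := le_max_left _ _
  have hv : 2 * |(1 - δ) ^ 2 * x.2| ≤ hbLyap δ x := le_max_right _ _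
  have hD : δ * |x.1| ≤ |(1 - (1 - δ) ^ 2) * x.1| := by
    rw [abs_mul]
    refine mul_le_mul_of_nonneg_right ?_ (abs_nonneg _)
    rw [abs_of_nonneg (by nlinarith)]
    nlinarith
  have h3 : |(1 - (1 - δ) ^ 2) * x.1|
      ≤ |(1 - (1 - δ) ^ 2) * x.1 - (1 - δ) ^ 2 * x.2| + |(1 - δ) ^ 2 * x.2| := by
    refine le_trans (le_of_eq ?_)
      (abs_add_le ((1 - (1 - δ) ^ 2) * x.1 - (1 - δ) ^ 2 * x.2) ((1 - δ) ^ 2 * x.2))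
    rw [sub_add_cancel]
  rw [div_mul_eq_mul_div, le_div_iff₀ (by positivity)]
  linarith

/-- A noise impulse has Lyapunov value of order one, so its effect on the position may reach order
`1/δ`; a displacement at rest, treated next, has value of order `δ`, so the bias loses no power of
`δ`. -/
lemma hbLyap_impulse_le {δ : ℝ} (h0 : 0 < δ) (h1 : δ ≤ 1) : hbLyap δ (-1, 1) ≤ 2 := by
  have hβ : 0 ≤ (1 - δ) ^ 2 := sq_nonneg _
  have hβ1 : (1 - δ) ^ 2 ≤ 1 := by nlinarith
  refine max_le ?_ ?_
  · rw [abs_le]; constructor <;> nlinarith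
  · rw [abs_of_nonneg (by linarith)]; linarith

lemma hbLyap_position_le {δ : ℝ} (h0 : 0 < δ) (h1 : δ ≤ 1) (y : ℝ) :
    hbLyap δ (y, 0) ≤ 2 * δ * |y| := by
  refine max_le ?_ ?_
  · simp only [mul_zero, sub_zero, abs_mul]
    refine mul_le_mul_of_nonneg_right ?_ (abs_nonneg _)
    rw [abs_of_nonneg (by nlinarith)]
    nlinarith
  · simp; positivity

/-- In the overdamped regime every step contracts. -/
lemma hbLyap_step_le {δ q : ℝ} (h0 : 0 < δ) (h1 : δ ≤ 1) (hq0 : 0 ≤ q)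
    (hq : q ≤ 8 / 7 * δ ^ 2) (hq2 : q ≤ 1 / 2) (x : ℝ × ℝ) :
    hbLyap δ (hbStep ((1 - δ) ^ 2) q x) ≤ (1 - q / (4 * δ)) * hbLyap δ x := by
  set F := hbLyap δ x with hF
  have hz : |(1 - (1 - δ) ^ 2) * x.1 - (1 - δ) ^ 2 * x.2| ≤ F := le_max_left _ _
  have hv : 2 * |(1 - δ) ^ 2 * x.2| ≤ F := le_max_right _ _
  have hF0 : 0 ≤ F := hbLyap_nonneg _ _
  set β := (1 - δ) ^ 2 with hβ
  have hβ0 : 0 ≤ β := sq_nonneg _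
  set D := 1 - β with hD
  have hDδ : D = δ * (2 - δ) := by rw [hD, hβ]; ring
  have hD0 : 0 < D := by rw [hDδ]; exact mul_pos h0 (by linarith)
  have hD2 : D ≤ 2 * δ := by rw [hDδ]; nlinarith
  -- This is the condition for the velocity part to contract. As `δ → 0` both sides of the estimate
  -- behave like `4δ²`, so `8/7` cannot be enlarged.
  have hqD : q * (3 * β + 1 / 2) ≤ D ^ 2 := by
    have : q * (3 * β + 1 / 2) ≤ 8 / 7 * δ ^ 2 * (3 * β + 1 / 2) :=
      mul_le_mul_of_nonneg_right hq (by linarith)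
    refine this.trans ?_
    have e : D ^ 2 - 8 / 7 * δ ^ 2 * (3 * β + 1 / 2)
        = δ ^ 2 * (δ * (20 - 17 * δ) / 7) := by rw [hDδ, hβ]; ring
    have : 0 ≤ δ ^ 2 * (δ * (20 - 17 * δ) / 7) := by
      have : 0 ≤ 20 - 17 * δ := by linarith
      positivity
    linarith
  have hqle : q ≤ D := by
    rw [hDδ]
    -- Up to `δ = 14/15` the bound `8/7 * δ²` is below `δ(2 - δ)`; beyond that `q ≤ 1/2` suffices.
    rcases le_total δ (14 / 15) with h | h <;> nlinarith
  have hrate : (D - q / 2) * F ≤ D * ((1 - q / (4 * δ)) * F) := by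
    rw [← mul_assoc]
    refine mul_le_mul_of_nonneg_right ?_ hF0
    have : D * (q / (4 * δ)) ≤ q / 2 := by
      rw [mul_div_assoc', div_le_iff₀ (by positivity)]
      nlinarith
    linarith
  rw [abs_le] at hz
  have hv' : |β * x.2| ≤ F / 2 := by linarith
  rw [abs_le] at hv'
  -- Slow and fast variables: `z / D` is the position where the motion would come to rest without
  -- gradient, and `z` is conserved when `q = 0`, while `v` is then multiplied by `β`. The weight 2
  -- on `v` lets the coupling terms of size `q` be absorbed.
  set z := D * x.1 - β * x.2 with hzdef
  set v := β * x.2 with hvdef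
  have hDy : D * x.1 = z + v := by rw [hzdef]; ring
  refine max_le ?_ ?_ <;> refine le_of_mul_le_mul_left (le_trans ?_ hrate) hD0
  · rw [← abs_of_pos hD0, ← abs_mul, abs_of_pos hD0]
    have e : D * ((1 - (1 - δ) ^ 2) * (hbStep β q x).1 - (1 - δ) ^ 2 * (hbStep β q x).2)
        = (D - q) * z - q * v := by
      simp only [hbStep_fst, hbStep_snd, ← hβ, ← hD]
      have : D * (D * (x.1 - (β * x.2 + q * x.1)) - β * (β * x.2 + q * x.1))
        = D * ((D * x.1) - (D + β) * (β * x.2)) - (D + β) * q * (D * x.1) := by ring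
      rw [this, hDy, ← hvdef, show D + β = 1 by rw [hD]; ring]; ring
    rw [e, abs_le]
    constructor <;> nlinarith
  · rw [← abs_of_pos hD0, mul_left_comm, ← abs_mul, abs_of_pos hD0]
    have e : D * ((1 - δ) ^ 2 * (hbStep β q x).2) = β * ((D + q) * v + q * z) := by
      simp only [hbStep_snd, ← hβ]
      have : D * (β * (β * x.2 + q * x.1)) = β * (D * (β * x.2) + q * (D * x.1)) := by ring
      rw [this, hDy, ← hvdef]; ring
    rw [e, abs_mul, abs_of_nonneg hβ0]
    have h4 : |(D + q) * v + q * z| ≤ (D + 3 * q) * F / 2 := by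
      rw [abs_le]; constructor <;> nlinarith
    have h5 : β * |(D + q) * v + q * z| ≤ β * ((D + 3 * q) * F / 2) :=
      mul_le_mul_of_nonneg_left h4 hβ0
    have h6 : β * (D + 3 * q) * F ≤ (D - q / 2) * F := by
      refine mul_le_mul_of_nonneg_right ?_ hF0
      have : D - β * D = D ^ 2 := by rw [hD]; ring
      nlinarith
    linarith

/-! ### Complex roots: an exactly geometric quadratic form -/

/-- The quadratic form that the heavy ball step with constant `q` multiplies by `β`. -/
def hbQuad (β q : ℝ) (x : ℝ × ℝ) : ℝ :=
  x.1 ^ 2 - (1 + β - q) * x.1 * (x.1 + x.2) + β * (x.1 + x.2) ^ 2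

/-- With `y = x.1` and previous position `y₋ = x.1 + x.2`, the recursion is `y₊ = (1 + β - q)y -
βy₋`, and the form is the Casoratian `y² - y₊y₋`. It is multiplied by the determinant `β` of the
recursion. -/
lemma hbQuad_step (β q : ℝ) (x : ℝ × ℝ) : hbQuad β q (hbStep β q x) = β * hbQuad β q x := by
  simp only [hbQuad, hbStep_fst, hbStep_snd]; ring

lemma hbQuad_flow {β : ℝ} {q : ℕ → ℝ} {s : ℕ} {r : ℝ} (x : ℝ × ℝ) (k : ℕ)
    (hq : ∀ j < k, q (s + j) = r) :
    hbQuad β r (hbFlow β q s x k) = β ^ k * hbQuad β r x := by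
  induction k with
  | zero => simp [hbFlow]
  | succ k ih =>
    rw [hbFlow, hq k (Nat.lt_succ_self k), hbQuad_step,
      ih fun j hj => hq j (hj.trans (Nat.lt_succ_self k))]
    ring

lemma hbFlow_overdamped {δ : ℝ} (h0 : 0 < δ) (h1 : δ ≤ 1) {q : ℕ → ℝ} {s : ℕ} {r : ℝ}
    (hr0 : 0 ≤ r) (hr : r ≤ 8 / 7 * δ ^ 2) (hr2 : r ≤ 1 / 2) (x : ℝ × ℝ) (k : ℕ)
    (hq : ∀ j < k, q (s + j) = r) :
    hbLyap δ (hbFlow ((1 - δ) ^ 2) q s x k) ≤ (1 - r / (4 * δ)) ^ k * hbLyap δ x := by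
  induction k with
  | zero => simp [hbFlow]
  | succ k ih =>
    rw [hbFlow, hq k (Nat.lt_succ_self k)]
    refine (hbLyap_step_le h0 h1 hr0 hr hr2 _).trans ?_
    rw [pow_succ' (1 - r / (4 * δ)), mul_assoc]
    refine mul_le_mul_of_nonneg_left (ih fun j hj => hq j (hj.trans (Nat.lt_succ_self k))) ?_
    rw [sub_nonneg, div_le_one (by positivity)]
    nlinarith

/-- The form is positive definite when the roots are complex. Staying at `8/7 * δ²`, away from the
double root `q = δ²`, keeps `4β - p²` above `δ²/14`; completing the square in either variable then
controls both positions, at the price of `1/δ²`. -/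
lemma hbLyap_sq_le_hbQuad {δ q : ℝ} (h0 : 0 < δ) (h1 : δ ≤ 1) (hq : 8 / 7 * δ ^ 2 ≤ q)
    (hq2 : q ≤ 1 / 2) (x : ℝ × ℝ) :
    hbLyap δ x ^ 2 ≤ 896 / δ ^ 2 * hbQuad ((1 - δ) ^ 2) q x := by
  set β := (1 - δ) ^ 2 with hβ
  have hβ0 : 0 ≤ β := sq_nonneg _
  have hβ1 : β ≤ 1 := by rw [hβ]; nlinarith
  set p := 1 + β - q with hp
  have hdisc : δ ^ 2 / 14 ≤ 4 * β - p ^ 2 := by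
    have e : 4 * β - p ^ 2 = (q - δ ^ 2) * ((2 - δ) ^ 2 - q) := by rw [hp, hβ]; ring
    have h2 : 1 / 2 ≤ (2 - δ) ^ 2 - q := by nlinarith
    have h3 : δ ^ 2 / 7 ≤ q - δ ^ 2 := by linarith
    rw [e]
    nlinarith [sq_nonneg δ]
  set y := x.1
  set w := x.1 + x.2 with hw
  have hx2 : x.2 = w - y := by rw [hw]; ring
  have hQ : hbQuad β q x = y ^ 2 - p * y * w + β * w ^ 2 := rfl
  set Q := hbQuad β q x
  have hw2 : δ ^ 2 / 14 * w ^ 2 ≤ 4 * Q := by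
    have : δ ^ 2 / 14 * w ^ 2 ≤ (4 * β - p ^ 2) * w ^ 2 :=
      mul_le_mul_of_nonneg_right hdisc (sq_nonneg _)
    rw [hQ]; nlinarith [sq_nonneg (2 * y - p * w)]
  have hQ0 : 0 ≤ Q := by nlinarith [sq_nonneg (δ * w)]
  have hy2 : δ ^ 2 / 14 * y ^ 2 ≤ 4 * Q := by
    have h3 : δ ^ 2 / 14 * y ^ 2 ≤ (4 * β - p ^ 2) * y ^ 2 :=
      mul_le_mul_of_nonneg_right hdisc (sq_nonneg _)
    have h4 : (4 * β - p ^ 2) * y ^ 2 ≤ 4 * β * Q := by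
      rw [hQ]; nlinarith [sq_nonneg (2 * β * w - p * y)]
    nlinarith
  have hu2 : δ ^ 2 * x.2 ^ 2 ≤ 224 * Q := by
    have e : δ ^ 2 * x.2 ^ 2 + (δ * (w + y)) ^ 2 = 2 * (δ ^ 2 * w ^ 2) + 2 * (δ ^ 2 * y ^ 2) := by
      rw [hx2]; ring
    linarith [sq_nonneg (δ * (w + y))]
  have hy2' : δ ^ 2 * y ^ 2 ≤ 56 * Q := by linarith
  have hβ2 : β ^ 2 ≤ 1 := by nlinarith
  have hDb : (1 - β) ^ 2 ≤ 1 := by nlinarith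
  rw [div_mul_eq_mul_div, le_div_iff₀ (by positivity)]
  clear_value Q w p
  have key1 : ((1 - β) * x.1 - β * x.2) ^ 2 * δ ^ 2 ≤ 896 * Q := by
    have a1 : ((1 - β) * x.1 - β * x.2) ^ 2 ≤ 2 * y ^ 2 + 2 * x.2 ^ 2 := by
      have : ((1 - β) * x.1 - β * x.2) ^ 2
          ≤ 2 * ((1 - β) ^ 2 * y ^ 2) + 2 * (β ^ 2 * x.2 ^ 2) := by
        linarith [sq_nonneg ((1 - β) * x.1 + β * x.2),
          (by ring : ((1 - β) * x.1 - β * x.2) ^ 2 + ((1 - β) * x.1 + β * x.2) ^ 2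
            = 2 * ((1 - β) ^ 2 * x.1 ^ 2) + 2 * (β ^ 2 * x.2 ^ 2))]
      linarith [mul_le_of_le_one_left (sq_nonneg y) hDb,
        mul_le_of_le_one_left (sq_nonneg x.2) hβ2]
    linarith [mul_le_mul_of_nonneg_right a1 (sq_nonneg δ)]
  have key2 : (2 * (β * x.2)) ^ 2 * δ ^ 2 ≤ 896 * Q := by
    have a1 : (2 * (β * x.2)) ^ 2 ≤ 4 * x.2 ^ 2 := by
      rw [mul_pow, mul_pow]
      linarith [mul_le_of_le_one_left (sq_nonneg x.2) hβ2]
    linarith [mul_le_mul_of_nonneg_right a1 (sq_nonneg δ)]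
  unfold hbLyap
  rcases max_choice |(1 - (1 - δ) ^ 2) * x.1 - (1 - δ) ^ 2 * x.2| (2 * |(1 - δ) ^ 2 * x.2|)
    with h | h <;> rw [h]
  · rw [sq_abs]; exact key1
  · rw [mul_pow, sq_abs, ← mul_pow]; exact key2

/-- The hypotheses force `δ ≤ 2/3`, so `β ≥ 1/9` and the velocity can be recovered from `β * x.2`.
-/
lemma hbQuad_le_hbLyap_sq {δ q : ℝ} (h0 : 0 < δ) (h1 : δ ≤ 1) (hq : 8 / 7 * δ ^ 2 ≤ q)
    (hq2 : q ≤ 1 / 2) (x : ℝ × ℝ) :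
    hbQuad ((1 - δ) ^ 2) q x ≤ 49 / δ ^ 2 * hbLyap δ x ^ 2 := by
  have hδ : δ ≤ 2 / 3 := by nlinarith
  have hy := abs_fst_le_hbLyap h0 h1 x
  have hv : 2 * |(1 - δ) ^ 2 * x.2| ≤ hbLyap δ x := le_max_right _ _
  set F := hbLyap δ x
  have hF0 : 0 ≤ F := hbLyap_nonneg _ _
  set G := F / δ with hG
  have hG0 : 0 ≤ G := by positivity
  have hFG : F = δ * G := by rw [hG]; field_simp
  have hy' : |x.1| ≤ 3 / 2 * G := by
    refine hy.trans (le_of_eq ?_); rw [hG]; field_simp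
  have hu' : |x.2| ≤ 4 * G := by
    rw [abs_mul, abs_of_nonneg (sq_nonneg _)] at hv
    have : 1 / 9 ≤ (1 - δ) ^ 2 := by nlinarith
    have h2 : (1 - δ) ^ 2 * |x.2| ≤ δ * G / 2 := by linarith
    have h3 : 1 / 9 * |x.2| ≤ (1 - δ) ^ 2 * |x.2| :=
      mul_le_mul_of_nonneg_right this (abs_nonneg _)
    nlinarith
  have e : 49 / δ ^ 2 * F ^ 2 = 49 * G ^ 2 := by rw [hG]; ring
  rw [e, hbQuad]
  have hβ0 : 0 ≤ (1 - δ) ^ 2 := sq_nonneg _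
  have hβ1 : (1 - δ) ^ 2 ≤ 1 := by nlinarith
  set β := (1 - δ) ^ 2
  have hw : |x.1 + x.2| ≤ 11 / 2 * G := (abs_add_le _ _).trans (by linarith)
  have e1 : x.1 ^ 2 ≤ (3 / 2 * G) ^ 2 := sq_le_sq' (by linarith [(abs_le.1 hy').1]) (abs_le.1 hy').2
  have e2 : (x.1 + x.2) ^ 2 ≤ (11 / 2 * G) ^ 2 :=
    sq_le_sq' (by linarith [(abs_le.1 hw).1]) (abs_le.1 hw).2
  have e3 : -((1 + β - q) * x.1 * (x.1 + x.2)) ≤ 2 * (3 / 2 * G) * (11 / 2 * G) := by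
    refine (neg_le_abs _).trans ?_
    rw [abs_mul, abs_mul]
    have : |1 + β - q| ≤ 2 := by rw [abs_le]; constructor <;> nlinarith
    gcongr
  nlinarith [sq_nonneg (x.1 + x.2)]

/-- In the underdamped regime the flow decays like `(1 - δ) ^ k`, up to a polynomial factor. -/
lemma hbFlow_underdamped {δ : ℝ} (h0 : 0 < δ) (h1 : δ ≤ 1) {q : ℕ → ℝ} {s : ℕ} {r : ℝ}
    (hr : 8 / 7 * δ ^ 2 ≤ r) (hr2 : r ≤ 1 / 2) (x : ℝ × ℝ) (k : ℕ)
    (hq : ∀ j < k, q (s + j) = r) :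
    hbLyap δ (hbFlow ((1 - δ) ^ 2) q s x k) ≤ 256 / δ ^ 2 * (1 - δ) ^ k * hbLyap δ x := by
  have h1δ : 0 ≤ 1 - δ := by linarith
  have hF0 := hbLyap_nonneg δ x
  refine abs_le_of_sq_le_sq' ?_ (by positivity) |>.2
  calc hbLyap δ (hbFlow ((1 - δ) ^ 2) q s x k) ^ 2
      ≤ 896 / δ ^ 2 * hbQuad ((1 - δ) ^ 2) r (hbFlow ((1 - δ) ^ 2) q s x k) :=
        hbLyap_sq_le_hbQuad h0 h1 hr hr2 _
    _ = 896 / δ ^ 2 * (((1 - δ) ^ 2) ^ k * hbQuad ((1 - δ) ^ 2) r x) := by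
        rw [hbQuad_flow x k hq]
    _ ≤ 896 / δ ^ 2 * (((1 - δ) ^ 2) ^ k * (49 / δ ^ 2 * hbLyap δ x ^ 2)) := by
        gcongr
        exact hbQuad_le_hbLyap_sq h0 h1 hr hr2 x
    _ = 43904 * ((1 / δ ^ 2) * (1 - δ) ^ k * hbLyap δ x) ^ 2 := by
        rw [← pow_mul, mul_comm 2 k, pow_mul]; ring
    _ ≤ 65536 * ((1 / δ ^ 2) * (1 - δ) ^ k * hbLyap δ x) ^ 2 := by gcongr; norm_num
    _ = (256 / δ ^ 2 * (1 - δ) ^ k * hbLyap δ x) ^ 2 := by ring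

/-! ### Stages of geometrically decreasing step size -/

/-- Standing assumptions on the horizon `T`, the number `n` of stages of length `K`, the momentum
parameter `δ` and the initial step size times curvature `q₀`. -/
structure StageRegime (T n K : ℕ) (δ q₀ : ℝ) : Prop where
  T_ge : 16 ≤ T
  n_pos : 1 ≤ n
  K_pos : 1 ≤ K
  K_le : K ≤ T
  T_sq_le : (T : ℝ) ^ 2 ≤ 4 * 4 ^ n
  δ_le : δ ≤ 1
  δ_ge : 4 / (T : ℝ) ≤ δ
  decay : δ = 1 ∨ 128 * Real.log T ≤ K * δ
  q_nonneg : 0 ≤ q₀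
  q_le : q₀ ≤ 1 / 2

/-- Step size times curvature, divided by four after each stage of length `K`. -/
def stageRate (q₀ : ℝ) (K t : ℕ) : ℝ := q₀ / 4 ^ (t / K)

lemma stageRate_stage (q₀ : ℝ) {K : ℕ} (ℓ j : ℕ) (hj : j < K) :
    stageRate q₀ K (ℓ * K + j) = q₀ / 4 ^ ℓ := by
  have : (ℓ * K + j) / K = ℓ := by
    rw [mul_comm, Nat.mul_add_div (by omega), Nat.div_eq_of_lt hj, add_zero]
  rw [stageRate, this]

namespace StageRegime

variable {T n K : ℕ} {δ q₀ : ℝ} (R : StageRegime T n K δ q₀)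
include R

lemma T_ge' : (16 : ℝ) ≤ T := by exact_mod_cast R.T_ge

lemma T_pos : (0 : ℝ) < T := by linarith [R.T_ge']

lemma K_pos' : (0 : ℝ) < K := by exact_mod_cast R.K_pos

lemma K_le' : (K : ℝ) ≤ T := by exact_mod_cast R.K_le

lemma δ_pos : 0 < δ := (div_pos four_pos R.T_pos).trans_le R.δ_ge

lemma inv_δ_le : 1 / δ ≤ T / 4 := by
  rw [div_le_iff₀ R.δ_pos]
  have := R.δ_ge
  rw [div_le_iff₀ R.T_pos] at this
  linarith

lemma rate_nonneg (ℓ : ℕ) : 0 ≤ q₀ / 4 ^ ℓ := div_nonneg R.q_nonneg (by positivity)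

lemma rate_le (ℓ : ℕ) : q₀ / 4 ^ ℓ ≤ q₀ :=
  div_le_self R.q_nonneg (one_le_pow₀ (by norm_num))

lemma rate_le_half (ℓ : ℕ) : q₀ / 4 ^ ℓ ≤ 1 / 2 := (R.rate_le ℓ).trans R.q_le

lemma decay_of_underdamped {r : ℝ} (hr2 : r ≤ 1 / 2) (hr : 8 / 7 * δ ^ 2 ≤ r) :
    128 * Real.log T ≤ K * δ := by
  rcases R.decay with h | h
  · rw [h] at hr; norm_num at hr; linarith
  · exact h

/-- Decay of the Lyapunov function over one full stage. -/
lemma full_stage {q : ℕ → ℝ} {s : ℕ} {r : ℝ} (hr0 : 0 ≤ r) (hr2 : r ≤ 1 / 2) (x : ℝ × ℝ)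
    (hq : ∀ j < K, q (s + j) = r) :
    hbLyap δ (hbFlow ((1 - δ) ^ 2) q s x K)
      ≤ Real.exp (-(K * (min r (δ ^ 2) / (4 * δ)))) * hbLyap δ x := by
  have hδ := R.δ_pos
  have hF := hbLyap_nonneg δ x
  rcases le_total r (8 / 7 * δ ^ 2) with hr | hr
  · refine (hbFlow_overdamped hδ R.δ_le hr0 hr hr2 x K hq).trans ?_
    refine mul_le_mul_of_nonneg_right ?_ hF
    have h1 : 1 - r / (4 * δ) ≤ Real.exp (-(r / (4 * δ))) := by
      linarith [Real.add_one_le_exp (-(r / (4 * δ)))]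
    have h0 : 0 ≤ 1 - r / (4 * δ) := by
      rw [sub_nonneg, div_le_one (by positivity)]; nlinarith [R.δ_le]
    refine (pow_le_pow_left₀ h0 h1 K).trans ?_
    rw [← Real.exp_nat_mul]
    refine Real.exp_le_exp.2 ?_
    rw [mul_neg, neg_le_neg_iff]
    gcongr
    exact min_le_left _ _
  · refine (hbFlow_underdamped hδ R.δ_le hr hr2 x K hq).trans ?_
    refine mul_le_mul_of_nonneg_right ?_ hF
    -- The prefactor `256/δ²` is at most `T^4`, which costs `4 log T` in the exponent; this is far
    -- less than the three quarters of `Kδ ≥ 128 log T` that the claimed rate leaves unused.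
    have hlog := R.decay_of_underdamped hr2 hr
    have h1 : (1 - δ) ^ K ≤ Real.exp (-(K * δ)) := by
      have h1 : 1 - δ ≤ Real.exp (-δ) := by linarith [Real.add_one_le_exp (-δ)]
      refine (pow_le_pow_left₀ (by linarith [R.δ_le]) h1 K).trans ?_
      rw [← Real.exp_nat_mul, mul_neg]
    have h2 : 256 / δ ^ 2 ≤ Real.exp (4 * Real.log T) := by
      have e : Real.exp (4 * Real.log T) = (T : ℝ) ^ 4 := by
        rw [mul_comm, Real.exp_mul, Real.exp_log R.T_pos]; norm_cast
      have : 256 / δ ^ 2 = 256 * (1 / δ) ^ 2 := by ring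
      rw [e, this]
      have h3 : (1 / δ) ^ 2 ≤ (T / 4) ^ 2 := pow_le_pow_left₀ (by positivity) R.inv_δ_le 2
      have h4 : (16 : ℝ) ^ 2 ≤ T ^ 2 := pow_le_pow_left₀ (by norm_num) R.T_ge' 2
      nlinarith [sq_nonneg (T : ℝ)]
    calc 256 / δ ^ 2 * (1 - δ) ^ K
        ≤ Real.exp (4 * Real.log T) * Real.exp (-(K * δ)) := by
          have := R.δ_le
          gcongr
      _ = Real.exp (4 * Real.log T - K * δ) := by rw [← Real.exp_add]; ring_nf
      _ ≤ _ := by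
        refine Real.exp_le_exp.2 ?_
        have : min r (δ ^ 2) / (4 * δ) ≤ δ / 4 := by
          rw [div_le_iff₀ (by positivity)]
          refine (min_le_right _ _).trans (le_of_eq (by ring))
        have := mul_le_mul_of_nonneg_left this R.K_pos'.le
        nlinarith [Real.log_nonneg (by linarith [R.T_ge'] : (1 : ℝ) ≤ T)]

/-- Stages can be chained because `hbLyap` does not depend on the step size, unlike `hbQuad`. -/
lemma full_stages (ℓ m : ℕ) (x : ℝ × ℝ) :
    hbLyap δ (hbFlow ((1 - δ) ^ 2) (stageRate q₀ K) (ℓ * K) x (m * K)) ≤ hbLyap δ x := by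
  induction m with
  | zero => simp [hbFlow]
  | succ m ih =>
    rw [add_mul, one_mul, hbFlow_add]
    refine (R.full_stage (R.rate_nonneg (ℓ + m)) (R.rate_le_half _) _ fun j hj => ?_).trans ?_
    · rw [← add_mul, stageRate_stage _ _ _ hj]
    · refine le_trans (mul_le_of_le_one_left (hbLyap_nonneg _ _) ?_) ih
      rw [Real.exp_le_one_iff, neg_nonpos]
      have := R.δ_pos
      have := le_min (R.rate_nonneg (ℓ + m)) (sq_nonneg δ)
      positivity

lemma full_stages_succ (ℓ m : ℕ) (hm : 1 ≤ m) (x : ℝ × ℝ) :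
    hbLyap δ (hbFlow ((1 - δ) ^ 2) (stageRate q₀ K) (ℓ * K) x (m * K))
      ≤ Real.exp (-(K * (min (q₀ / 4 ^ ℓ) (δ ^ 2) / (4 * δ)))) * hbLyap δ x := by
  obtain ⟨m, rfl⟩ := Nat.exists_eq_add_of_le hm
  rw [add_mul, one_mul, hbFlow_add]
  have h1 := R.full_stages (ℓ + 1) m (hbFlow ((1 - δ) ^ 2) (stageRate q₀ K) (ℓ * K) x K)
  rw [add_mul, one_mul] at h1
  exact h1.trans (R.full_stage (R.rate_nonneg ℓ) (R.rate_le_half ℓ) x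
    fun j hj => stageRate_stage _ _ _ hj)

/-- Decay of the contribution of the initial point. -/
lemma bias_sq_le (y : ℝ) :
    (hbFlow ((1 - δ) ^ 2) (stageRate q₀ K) 0 (y, 0) (n * K)).1 ^ 2
      ≤ 9 * Real.exp (-(K * (min q₀ (δ ^ 2) / (2 * δ)))) * y ^ 2 := by
  have hδ := R.δ_pos
  have h := R.full_stages_succ 0 n R.n_pos (y, 0)
  rw [zero_mul, pow_zero, div_one] at h
  have h2 := abs_fst_le_hbLyap hδ R.δ_le
    (hbFlow ((1 - δ) ^ 2) (stageRate q₀ K) 0 (y, 0) (n * K))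
  have h3 : |(hbFlow ((1 - δ) ^ 2) (stageRate q₀ K) 0 (y, 0) (n * K)).1|
      ≤ 3 * Real.exp (-(K * (min q₀ (δ ^ 2) / (4 * δ)))) * |y| := by
    refine h2.trans ?_
    calc _ ≤ 3 / (2 * δ) * (Real.exp (-(K * (min q₀ (δ ^ 2) / (4 * δ)))) * (2 * δ * |y|)) := by
          gcongr
          refine h.trans ?_
          gcongr
          exact hbLyap_position_le hδ R.δ_le y
      _ = _ := by field_simp
  rw [← sq_abs]
  refine (pow_le_pow_left₀ (abs_nonneg _) h3 2).trans (le_of_eq ?_)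
  rw [mul_pow, mul_pow, sq_abs, ← Real.exp_nat_mul]
  congr 2
  · norm_num
  · congr 1
    push_cast
    field_simp
    ring

/-- Response at the final time to a unit impulse at step `r + 1` before the end of stage `ℓ`. -/
lemma response_le (ℓ r : ℕ) (hℓ : ℓ < n) (hr : r < K) {B E : ℝ}
    (hB : ∀ s, (∀ j < r, stageRate q₀ K (s + j) = q₀ / 4 ^ ℓ) →
      hbLyap δ (hbFlow ((1 - δ) ^ 2) (stageRate q₀ K) s (-1, 1) r) ≤ B * hbLyap δ (-1, 1))
    (hB0 : 0 ≤ B)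
    (hE : ∀ x, hbLyap δ (hbFlow ((1 - δ) ^ 2) (stageRate q₀ K) ((ℓ + 1) * K) x
      ((n - 1 - ℓ) * K)) ≤ E * hbLyap δ x) (hE0 : 0 ≤ E) :
    (hbFlow ((1 - δ) ^ 2) (stageRate q₀ K) (ℓ * K + (K - 1 - r) + 1) (-1, 1)
      (n * K - (ℓ * K + (K - 1 - r) + 1))).1 ^ 2 ≤ (3 / δ * (E * B)) ^ 2 := by
  have hδ := R.δ_pos
  -- After the impulse there remain `r` steps of stage `ℓ` and then `n - 1 - ℓ` complete stages.
  have e1 : n * K - (ℓ * K + (K - 1 - r) + 1) = r + (n - 1 - ℓ) * K := by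
    have : n * K = (n - 1 - ℓ) * K + ℓ * K + K := by
      rw [← add_mul]; nth_rewrite 3 [← one_mul K]; rw [← add_mul]; congr 1; omega
    omega
  have e2 : ℓ * K + (K - 1 - r) + 1 + r = (ℓ + 1) * K := by rw [add_mul]; omega
  rw [e1, hbFlow_add, e2, ← sq_abs]
  refine pow_le_pow_left₀ (abs_nonneg _) ?_ 2
  refine (abs_fst_le_hbLyap hδ R.δ_le _).trans ?_
  have h1 := hB (ℓ * K + (K - 1 - r) + 1) fun j hj => by
    rw [show ℓ * K + (K - 1 - r) + 1 + j = ℓ * K + ((K - 1 - r) + 1 + j) by ring]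
    exact stageRate_stage _ _ _ (by omega)
  have h2 := hbLyap_impulse_le hδ R.δ_le
  calc _ ≤ 3 / (2 * δ) * (E * (B * 2)) := by
        gcongr
        refine (hE _).trans ?_
        gcongr
        exact h1.trans (by gcongr)
    _ = _ := by field_simp

/-- With `p = q/(4δ)`, an impulse `r` steps before the end of the stage contributes at most a
multiple of `E²p²(1 - p)^r`, where `E` is the damping by later stages. The geometric series leaves
`E²p`, and counting terms leaves `Kp²`; these give the two entries of the minimum. -/
lemma stage_sum_overdamped (ℓ : ℕ) (hℓ : ℓ < n) (hr : q₀ / 4 ^ ℓ ≤ 8 / 7 * δ ^ 2) :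
    ∑ r ∈ Finset.range K, (q₀ / 4 ^ ℓ) ^ 2 *
      (hbFlow ((1 - δ) ^ 2) (stageRate q₀ K) (ℓ * K + (K - 1 - r) + 1) (-1, 1)
        (n * K - (ℓ * K + (K - 1 - r) + 1))).1 ^ 2
      ≤ 288 * (min (1 : ℝ) (((K : ℝ) * (q₀ / (4 * δ))) ^ 2) / (K : ℝ)) := by
  have hδ := R.δ_pos
  have hK := R.K_pos'
  set q := q₀ / 4 ^ ℓ with hq
  have hq0 : 0 ≤ q := R.rate_nonneg ℓ
  set p := q / (4 * δ) with hp
  have hp0 : 0 ≤ p := by positivity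
  have hp1 : p ≤ 1 := by rw [hp, div_le_one (by positivity)]; nlinarith [R.δ_le]
  have hpp : p ≤ q₀ / (4 * δ) := by rw [hp]; gcongr; exact R.rate_le ℓ
  -- The next stage contracts at rate `p/4`, so `E = exp(-Kp/4)` and `pE² ≤ 2/K` whatever `p` is.
  -- After the last stage nothing damps, but there `q ≤ 8/T²` and `δ ≥ 4/T` already make `p ≤ 2/T`.
  obtain ⟨E, hE0, hE1, hpE, hE⟩ : ∃ E : ℝ, 0 ≤ E ∧ E ≤ 1 ∧ p * E ^ 2 ≤ 2 / K ∧
      ∀ x, hbLyap δ (hbFlow ((1 - δ) ^ 2) (stageRate q₀ K) ((ℓ + 1) * K) x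
        ((n - 1 - ℓ) * K)) ≤ E * hbLyap δ x := by
    rcases Nat.lt_or_ge (ℓ + 1) n with h | h
    · refine ⟨Real.exp (-(K * (p / 4))), (Real.exp_pos _).le, ?_, ?_, fun x => ?_⟩
      · rw [Real.exp_le_one_iff, neg_nonpos]; positivity
      · rw [← Real.exp_nat_mul, le_div_iff₀ hK]
        set X := K * p / 2 with hX
        have e : ((2 : ℕ) : ℝ) * -(K * (p / 4)) = -X := by rw [hX]; push_cast; ring
        rw [e, Real.exp_neg]
        have h1 : X ≤ Real.exp X := by linarith [Real.add_one_le_exp X]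
        have h2 : X * (Real.exp X)⁻¹ ≤ 1 := by
          rw [← div_eq_mul_inv]; exact div_le_one_of_le₀ h1 (Real.exp_pos _).le
        have e2 : p * (Real.exp X)⁻¹ * K = 2 * (X * (Real.exp X)⁻¹) := by rw [hX]; ring
        linarith
      · have h1 := R.full_stages_succ (ℓ + 1) (n - 1 - ℓ) (by omega) x
        have h2 : q₀ / 4 ^ (ℓ + 1) = q / 4 := by rw [hq, pow_succ]; field_simp
        rw [h2, min_eq_left (by nlinarith [sq_nonneg δ])] at h1
        refine h1.trans (le_of_eq ?_)
        congr 4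
        rw [hp]; ring
    · refine ⟨1, zero_le_one, le_rfl, ?_, fun x => ?_⟩
      · have hn : n = ℓ + 1 := by omega
        have h1 : (T : ℝ) ^ 2 ≤ 16 * 4 ^ ℓ := by
          have := R.T_sq_le; rw [hn, pow_succ (4 : ℝ)] at this; linarith
        have h2 : q * T ^ 2 ≤ 8 := by
          rw [hq, div_mul_eq_mul_div, div_le_iff₀ (by positivity)]
          nlinarith [R.q_nonneg, R.q_le, sq_nonneg (T : ℝ)]
        have h3 : p * T ≤ 2 := by
          have e : p * T = q * (T / 4) * (1 / δ) := by rw [hp]; ring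
          rw [e]
          have := R.inv_δ_le
          have := R.T_pos
          calc q * (T / 4) * (1 / δ) ≤ q * (T / 4) * (T / 4) := by gcongr
            _ ≤ 2 := by nlinarith
        rw [one_pow, mul_one, le_div_iff₀ hK]
        exact (mul_le_mul_of_nonneg_left R.K_le' hp0).trans h3
      · rw [one_mul]; exact R.full_stages _ _ _
  have hterm : ∀ r ∈ Finset.range K, q ^ 2 *
      (hbFlow ((1 - δ) ^ 2) (stageRate q₀ K) (ℓ * K + (K - 1 - r) + 1) (-1, 1)
        (n * K - (ℓ * K + (K - 1 - r) + 1))).1 ^ 2 ≤ 144 * (E ^ 2 * p ^ 2 * (1 - p) ^ r) := by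
    intro r hrK
    have h1 : (1 - p) ^ r ≤ 1 := pow_le_one₀ (by linarith) (by linarith)
    have h2 : 0 ≤ (1 - p) ^ r := pow_nonneg (by linarith) _
    have := R.response_le ℓ r hℓ (Finset.mem_range.1 hrK) (B := (1 - p) ^ r) (E := E)
      (fun s hs => hbFlow_overdamped hδ R.δ_le hq0 hr (R.rate_le_half ℓ) _ r hs) h2 hE hE0
    calc _ ≤ q ^ 2 * (3 / δ * (E * (1 - p) ^ r)) ^ 2 := by gcongr
      _ = 144 * (E ^ 2 * p ^ 2 * ((1 - p) ^ r * (1 - p) ^ r)) := by rw [hp]; field_simp; ring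
      _ ≤ _ := by
        gcongr
        exact mul_le_of_le_one_left h2 h1
  refine (Finset.sum_le_sum hterm).trans ?_
  rw [← Finset.mul_sum, ← Finset.mul_sum]
  set G := ∑ r ∈ Finset.range K, (1 - p) ^ r
  have hG1 : p * G ≤ 1 := by
    have h := mul_neg_geom_sum (1 - p) K
    rw [sub_sub_cancel] at h
    rw [h]
    linarith [pow_nonneg (by linarith : 0 ≤ 1 - p) K]
  have hG2 : G ≤ K := by
    refine (Finset.sum_le_card_nsmul _ _ 1 fun r _ =>
      pow_le_one₀ (by linarith) (by linarith)).trans (by simp)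
  have hG0 : 0 ≤ G := Finset.sum_nonneg fun r _ => pow_nonneg (by linarith) _
  have b1 : E ^ 2 * p ^ 2 * G ≤ 2 / K := by
    calc E ^ 2 * p ^ 2 * G = (p * E ^ 2) * (p * G) := by ring
      _ ≤ p * E ^ 2 := mul_le_of_le_one_right (by positivity) hG1
      _ ≤ _ := hpE
  have b2 : E ^ 2 * p ^ 2 * G ≤ (K * (q₀ / (4 * δ))) ^ 2 / K := by
    calc E ^ 2 * p ^ 2 * G ≤ 1 ^ 2 * (q₀ / (4 * δ)) ^ 2 * K := by gcongr
      _ = _ := by field_simp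
  rcases le_total 1 ((K * (q₀ / (4 * δ))) ^ 2) with h | h
  · rw [min_eq_left h]
    calc _ ≤ 144 * (2 / (K : ℝ)) := by gcongr
      _ = _ := by ring
  · rw [min_eq_right h]
    have : 0 ≤ (K * (q₀ / (4 * δ))) ^ 2 / K := by positivity
    linarith

/-- Such a stage is never the last one, since the final rate is below `δ²`; the following complete
stage therefore makes its noise polynomially negligible. -/
lemma stage_sum_underdamped (ℓ : ℕ) (hℓ : ℓ < n) (hr : 8 / 7 * δ ^ 2 ≤ q₀ / 4 ^ ℓ) :
    ∑ r ∈ Finset.range K, (q₀ / 4 ^ ℓ) ^ 2 *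
      (hbFlow ((1 - δ) ^ 2) (stageRate q₀ K) (ℓ * K + (K - 1 - r) + 1) (-1, 1)
        (n * K - (ℓ * K + (K - 1 - r) + 1))).1 ^ 2
      ≤ 288 * (min (1 : ℝ) (((K : ℝ) * (q₀ / (4 * δ))) ^ 2) / (K : ℝ)) := by
  have hδ := R.δ_pos
  have hK := R.K_pos'
  have hT := R.T_pos
  have hT16 := R.T_ge'
  have hq0 : 0 ≤ q₀ := R.q_nonneg
  have hlog := R.decay_of_underdamped (R.rate_le_half ℓ) hr
  have hn : ℓ + 1 < n := by
    by_contra h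
    have hn : n = ℓ + 1 := by omega
    have h1 : (T : ℝ) ^ 2 ≤ 16 * 4 ^ ℓ := by
      have := R.T_sq_le; rw [hn, pow_succ (4 : ℝ)] at this; linarith
    have h2 : q₀ / 4 ^ ℓ * T ^ 2 ≤ 8 := by
      rw [div_mul_eq_mul_div, div_le_iff₀ (by positivity)]
      nlinarith [R.q_nonneg, R.q_le, sq_nonneg (T : ℝ)]
    have h3 : 4 ≤ δ * T := by have := R.δ_ge; rwa [div_le_iff₀ hT] at this
    nlinarith [mul_le_mul_of_nonneg_right hr (sq_nonneg (T : ℝ))]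
  have hterm : ∀ r ∈ Finset.range K, (q₀ / 4 ^ ℓ) ^ 2 *
      (hbFlow ((1 - δ) ^ 2) (stageRate q₀ K) (ℓ * K + (K - 1 - r) + 1) (-1, 1)
        (n * K - (ℓ * K + (K - 1 - r) + 1))).1 ^ 2 ≤ q₀ ^ 2 * (1 / (T : ℝ) ^ 5) ^ 2 := by
    intro r hrK
    -- The next rate is at least `2δ²/7`, so its exponent is at least `Kδ/14 ≥ (128/14) log T > 9
    -- log T`. The factor `T^(-9)` beats `768/δ³ ≤ 12T³` and leaves at most `T^(-5)`.
    have := R.response_le ℓ r hℓ (Finset.mem_range.1 hrK) (B := 256 / δ ^ 2)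
      (E := Real.exp (-(9 * Real.log T)))
      (fun s hs => by
        refine (hbFlow_underdamped hδ R.δ_le hr (R.rate_le_half ℓ) _ r hs).trans ?_
        refine mul_le_mul_of_nonneg_right ?_ (hbLyap_nonneg _ _)
        exact mul_le_of_le_one_right (by positivity)
          (pow_le_one₀ (by linarith [R.δ_le]) (by linarith)))
      (by positivity)
      (fun x => by
        refine (R.full_stages_succ (ℓ + 1) (n - 1 - ℓ) (by omega) x).trans ?_
        refine mul_le_mul_of_nonneg_right (Real.exp_le_exp.2 ?_) (hbLyap_nonneg _ _)
        have h2 : q₀ / 4 ^ (ℓ + 1) = q₀ / 4 ^ ℓ / 4 := by rw [pow_succ]; field_simp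
        have h3 : 2 / 7 * δ ^ 2 ≤ min (q₀ / 4 ^ (ℓ + 1)) (δ ^ 2) :=
          le_min (by rw [h2]; linarith) (by nlinarith [sq_nonneg δ])
        have h4 : δ / 14 ≤ min (q₀ / 4 ^ (ℓ + 1)) (δ ^ 2) / (4 * δ) := by
          rw [le_div_iff₀ (by positivity)]; linarith
        have := mul_le_mul_of_nonneg_left h4 hK.le
        nlinarith [Real.log_nonneg (by linarith : (1 : ℝ) ≤ T)])
      (Real.exp_pos _).le
    refine mul_le_mul (pow_le_pow_left₀ (R.rate_nonneg ℓ) (R.rate_le ℓ) 2) (this.trans ?_)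
      (sq_nonneg _) (sq_nonneg _)
    refine pow_le_pow_left₀ (by positivity) ?_ 2
    have e : Real.exp (-(9 * Real.log T)) = 1 / (T : ℝ) ^ 9 := by
      rw [Real.exp_neg, mul_comm, Real.exp_mul, Real.exp_log hT, one_div]; norm_cast
    rw [e]
    have h3 : (1 / δ) ^ 3 ≤ (T / 4) ^ 3 := pow_le_pow_left₀ (by positivity) R.inv_δ_le 3
    calc 3 / δ * (1 / (T : ℝ) ^ 9 * (256 / δ ^ 2)) = 768 * (1 / δ) ^ 3 / (T : ℝ) ^ 9 := by
          ring
      _ ≤ 768 * ((T : ℝ) / 4) ^ 3 / (T : ℝ) ^ 9 := by gcongr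
      _ = 12 / (T : ℝ) * (1 / (T : ℝ) ^ 5) := by field_simp; norm_num
      _ ≤ 1 / (T : ℝ) ^ 5 := mul_le_of_le_one_left (by positivity)
          (by rw [div_le_one hT]; linarith)
  refine (Finset.sum_le_sum hterm).trans ?_
  rw [Finset.sum_const, Finset.card_range, nsmul_eq_mul]
  have hT1 : (1 : ℝ) ≤ T := by linarith
  have h9 : K * (1 / (T : ℝ) ^ 5) ^ 2 ≤ 1 / T := by
    calc (K : ℝ) * (1 / (T : ℝ) ^ 5) ^ 2 ≤ (T : ℝ) * (1 / (T : ℝ) ^ 5) ^ 2 := by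
          gcongr; exact R.K_le
      _ = 1 / (T : ℝ) ^ 9 := by field_simp
      _ ≤ 1 / (T : ℝ) ^ 1 := one_div_le_one_div_of_le (by positivity)
          (pow_le_pow_right₀ hT1 (by norm_num))
      _ = 1 / (T : ℝ) := by rw [pow_one]
  have hTK : 1 / (T : ℝ) ≤ 1 / (K : ℝ) := one_div_le_one_div_of_le hK R.K_le'
  have hK1 : (1 : ℝ) ≤ K := by exact_mod_cast R.K_pos
  have hX : K * (q₀ ^ 2 * (1 / (T : ℝ) ^ 5) ^ 2) ≤ q₀ ^ 2 * (1 / T) := by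
    calc _ = q₀ ^ 2 * (K * (1 / (T : ℝ) ^ 5) ^ 2) := by ring
      _ ≤ _ := by gcongr
  refine hX.trans ?_
  rcases le_total 1 ((K * (q₀ / (4 * δ))) ^ 2) with h | h
  · rw [min_eq_left h]
    have : q₀ ^ 2 ≤ 1 := by nlinarith [R.q_le]
    calc q₀ ^ 2 * (1 / (T : ℝ)) ≤ 1 * (1 / (K : ℝ)) := by gcongr
      _ ≤ _ := by have : 0 < 1 / (K : ℝ) := by positivity
                  linarith
  · rw [min_eq_right h]
    have e : (K * (q₀ / (4 * δ))) ^ 2 / K = q₀ ^ 2 * (K / 16 * (1 / δ) ^ 2) := by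
      field_simp; norm_num
    rw [e]
    have h1 : 1 ≤ 1 / δ := by rw [le_div_iff₀ hδ]; linarith [R.δ_le]
    have h2 : 1 / (T : ℝ) ≤ 1 / (16 : ℝ) := by gcongr
    calc q₀ ^ 2 * (1 / (T : ℝ)) ≤ q₀ ^ 2 * (288 * (1 / 16 * 1 ^ 2)) := by gcongr; linarith
      _ ≤ q₀ ^ 2 * (288 * (K / 16 * (1 / δ) ^ 2)) := by gcongr
      _ = _ := by ring

/-- Total amplification of unit gradient noise in one eigendirection. -/
lemma variance_sum_le :
    ∑ s ∈ Finset.range (n * K), stageRate q₀ K s ^ 2 *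
      (hbFlow ((1 - δ) ^ 2) (stageRate q₀ K) (s + 1) (-1, 1) (n * K - (s + 1))).1 ^ 2
      ≤ n * (288 * (min 1 (((K : ℝ) * (q₀ / (4 * δ))) ^ 2) / K)) := by
  have key : ∀ m ≤ n, ∑ s ∈ Finset.range (m * K), stageRate q₀ K s ^ 2 *
      (hbFlow ((1 - δ) ^ 2) (stageRate q₀ K) (s + 1) (-1, 1) (n * K - (s + 1))).1 ^ 2
      ≤ m * (288 * (min 1 (((K : ℝ) * (q₀ / (4 * δ))) ^ 2) / K)) := by
    intro m
    induction m with
    | zero => simp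
    | succ m ih =>
      intro hm
      rw [add_mul, one_mul, Finset.sum_range_add, Nat.cast_add, Nat.cast_one, add_mul, one_mul]
      refine add_le_add (ih (by omega)) ?_
      rw [← Finset.sum_range_reflect]
      refine le_trans (le_of_eq (Finset.sum_congr rfl fun r hr => ?_))
        ((le_total (q₀ / 4 ^ m) (8 / 7 * δ ^ 2)).elim (R.stage_sum_overdamped m hm)
          (R.stage_sum_underdamped m hm))
      have := Finset.mem_range.1 hr
      rw [stageRate_stage _ _ _ (by omega)]
  exact key n le_rfl

end StageRegime

/-! ### Power-law sums -/

lemma sum_rpow_tail_le {s : ℝ} (hs : 1 < s) (m a : ℕ) (hm : 1 ≤ m) :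
    ∑ i ∈ Finset.range a, ((m : ℝ) + ((i + 1 : ℕ) : ℝ)) ^ (-s) ≤ (m : ℝ) ^ (1 - s) / (s - 1) := by
  have hm0 : (0 : ℝ) < m := by exact_mod_cast hm
  have hanti : AntitoneOn (fun x : ℝ => x ^ (-s)) (Set.Icc (m : ℝ) (m + a)) := by
    intro x hx y _ hxy
    exact Real.rpow_le_rpow_of_nonpos (hm0.trans_le hx.1) hxy (by linarith)
  refine hanti.sum_le_integral.trans ?_
  rw [integral_rpow]
  · have h1 : (0 : ℝ) ≤ ((m : ℝ) + a) ^ (-(s - 1)) := by positivity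
    rw [show -s + 1 = -(s - 1) by ring, div_neg, ← neg_div, neg_sub]
    rw [show 1 - s = -(s - 1) by ring]
    refine div_le_div_of_nonneg_right ?_ (by linarith)
    linarith
  · right
    refine ⟨by linarith, ?_⟩
    rw [Set.uIcc_of_le (by linarith [(Nat.cast_nonneg a : (0 : ℝ) ≤ a)])]
    intro h
    linarith [h.1]

/-- About `M` terms are capped at one, and the tail beyond `⌊M⌋` is compared with an integral. The
linear bound holds also for `M < 1`, which is reduced to `M = 1` by `M^s ≤ M`. -/
lemma sum_min_rpow_le {s : ℝ} (hs : 1 < s) {M : ℝ} (hM : 0 < M) (d : ℕ) :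
    ∑ i ∈ Finset.range d, min 1 ((((i : ℝ) + 1) / M) ^ (-s))
      ≤ (1 + 2 ^ (s - 1) / (s - 1)) * M := by
  have key : ∀ M : ℝ, 1 ≤ M → ∑ i ∈ Finset.range d, min 1 ((((i : ℝ) + 1) / M) ^ (-s))
      ≤ (1 + 2 ^ (s - 1) / (s - 1)) * M := by
    intro M hM
    have hM0 : 0 < M := by linarith
    set m := ⌊M⌋₊ with hm
    have hm1 : 1 ≤ m := Nat.le_floor (by simpa using hM)
    have hmM : (m : ℝ) ≤ M := Nat.floor_le hM0.le
    have hm2 : M / 2 ≤ m := by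
      have := Nat.lt_floor_add_one M
      have : (1 : ℝ) ≤ m := by exact_mod_cast hm1
      linarith
    have hnn : ∀ i : ℕ, 0 ≤ min 1 ((((i : ℝ) + 1) / M) ^ (-s)) := fun i =>
      le_min zero_le_one (by positivity)
    calc ∑ i ∈ Finset.range d, min 1 ((((i : ℝ) + 1) / M) ^ (-s))
        ≤ ∑ i ∈ Finset.range (m + d), min 1 ((((i : ℝ) + 1) / M) ^ (-s)) :=
          Finset.sum_le_sum_of_subset_of_nonneg
            (Finset.range_mono (by omega)) fun i _ _ => hnn i
      _ = ∑ i ∈ Finset.range m, min 1 ((((i : ℝ) + 1) / M) ^ (-s))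
          + ∑ i ∈ Finset.range d, min 1 (((((m + i : ℕ) : ℝ) + 1) / M) ^ (-s)) :=
          Finset.sum_range_add _ _ _
      _ ≤ m + ∑ i ∈ Finset.range d, M ^ s * ((m : ℝ) + ((i + 1 : ℕ) : ℝ)) ^ (-s) := by
          refine add_le_add ?_ (Finset.sum_le_sum fun i _ => ?_)
          · refine (Finset.sum_le_card_nsmul _ _ 1 fun i _ => min_le_left _ _).trans ?_
            simp
          · refine (min_le_right _ _).trans (le_of_eq ?_)
            rw [Real.div_rpow (by positivity) hM0.le, Real.rpow_neg hM0.le, div_inv_eq_mul,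
              mul_comm]
            push_cast
            ring_nf
      _ ≤ m + M ^ s * ((m : ℝ) ^ (1 - s) / (s - 1)) := by
          rw [← Finset.mul_sum]
          gcongr
          exact sum_rpow_tail_le hs m d hm1
      _ ≤ M + M ^ s * ((M / 2) ^ (1 - s) / (s - 1)) := by
          have h1 : (m : ℝ) ^ (1 - s) ≤ (M / 2) ^ (1 - s) :=
            Real.rpow_le_rpow_of_nonpos (by positivity) hm2 (by linarith)
          have h2 : 0 < s - 1 := by linarith
          gcongr
      _ = _ := by
          rw [Real.div_rpow hM0.le (by norm_num), show s - 1 = -(1 - s) by ring,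
            Real.rpow_neg (by norm_num : (0 : ℝ) ≤ 2)]
          have : M ^ s * M ^ (1 - s) = M := by rw [← Real.rpow_add hM0]; simp
          have h2 : M ^ s * (M ^ (1 - s) / 2 ^ (1 - s) / -(1 - s))
            = (M ^ s * M ^ (1 - s)) * ((2 ^ (1 - s))⁻¹ / -(1 - s)) := by ring
          rw [h2, this]; ring
  rcases le_total 1 M with h | h
  · exact key M h
  · have h1 := key 1 le_rfl
    calc ∑ i ∈ Finset.range d, min 1 ((((i : ℝ) + 1) / M) ^ (-s))
        ≤ ∑ i ∈ Finset.range d, M * min 1 ((((i : ℝ) + 1) / 1) ^ (-s)) := by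
          refine Finset.sum_le_sum fun i _ => ?_
          have hle : ((i : ℝ) + 1) ^ (-s) ≤ 1 :=
            Real.rpow_le_one_of_one_le_of_nonpos (by linarith [(Nat.cast_nonneg i : (0:ℝ) ≤ i)])
              (by linarith)
          rw [div_one, min_eq_right hle]
          refine (min_le_right _ _).trans ?_
          rw [Real.div_rpow (by positivity) hM.le, Real.rpow_neg hM.le, div_inv_eq_mul, mul_comm]
          refine mul_le_mul_of_nonneg_right ?_ (by positivity)
          calc M ^ s ≤ M ^ (1 : ℝ) := Real.rpow_le_rpow_of_exponent_ge hM h hs.le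
            _ = M := Real.rpow_one M
      _ = M * ∑ i ∈ Finset.range d, min 1 ((((i : ℝ) + 1) / 1) ^ (-s)) := by
          rw [Finset.mul_sum]
      _ ≤ M * ((1 + 2 ^ (s - 1) / (s - 1)) * 1) := by gcongr
      _ = _ := by ring

/-- The inequality `x ≤ exp x` at `x = κy/p`, raised to the power `p`. -/
lemma rpow_mul_exp_neg_le {p κ y : ℝ} (hp : 0 < p) (hκ : 0 < κ) (hy : 0 ≤ y) :
    y ^ p * Real.exp (-(κ * y)) ≤ (p / κ) ^ p := by
  have h1 : κ * y / p ≤ Real.exp (κ * y / p) := by linarith [Real.add_one_le_exp (κ * y / p)]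
  have h2 : (κ * y / p) ^ p ≤ Real.exp (κ * y) := by
    refine (Real.rpow_le_rpow (by positivity) h1 hp.le).trans (le_of_eq ?_)
    rw [← Real.exp_mul]; congr 1; field_simp
  have h3 : y ^ p = (p / κ) ^ p * (κ * y / p) ^ p := by
    rw [← Real.mul_rpow (by positivity) (by positivity)]; congr 1; field_simp
  rw [h3, mul_assoc, Real.exp_neg, ← div_eq_mul_inv]
  exact mul_le_of_le_one_right (by positivity) (div_le_one_of_le₀ h2 (Real.exp_pos _).le)

/-- The source-weighted sum of exponentially damped eigendirections. -/
lemma sum_rpow_mul_exp_le {a b κ : ℝ} (ha : 0 < a) (hb : 1 < b) (hκ : 0 < κ) {M : ℝ}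
    (hM : 0 < M) (d : ℕ) :
    ∑ i ∈ Finset.range d,
        ((i : ℝ) + 1) ^ (-b) * Real.exp (-(κ * (((i : ℝ) + 1) / M) ^ (-a)))
      ≤ max 1 ((b / a / κ) ^ (b / a)) * (1 + 2 ^ (b - 1) / (b - 1)) * M ^ (1 - b) := by
  set C := max 1 ((b / a / κ) ^ (b / a)) with hC
  have hC1 : 1 ≤ C := le_max_left _ _
  have hterm : ∀ i ∈ Finset.range d,
      ((i : ℝ) + 1) ^ (-b) * Real.exp (-(κ * (((i : ℝ) + 1) / M) ^ (-a)))
        ≤ C * M ^ (-b) * min 1 ((((i : ℝ) + 1) / M) ^ (-b)) := by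
    intro i _
    set x := ((i : ℝ) + 1) / M with hx
    have hx0 : 0 < x := by positivity
    have e : ((i : ℝ) + 1) ^ (-b) = M ^ (-b) * x ^ (-b) := by
      rw [← Real.mul_rpow hM.le hx0.le, hx]; congr 1; field_simp
    rw [e, mul_comm C, mul_assoc, mul_assoc]
    refine mul_le_mul_of_nonneg_left ?_ (by positivity)
    rw [mul_min_of_nonneg _ _ (by linarith)]
    refine le_min ?_ ?_
    · rw [mul_one]
      refine le_trans ?_ (le_max_right _ _)
      have := rpow_mul_exp_neg_le (p := b / a) (κ := κ) (y := x ^ (-a)) (by positivity) hκ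
        (by positivity)
      rwa [← Real.rpow_mul hx0.le, show -a * (b / a) = -b by field_simp] at this
    · rw [mul_comm]
      refine mul_le_mul_of_nonneg_right (le_trans ?_ hC1) (by positivity)
      rw [Real.exp_le_one_iff, neg_nonpos]; positivity
  refine (Finset.sum_le_sum hterm).trans ?_
  rw [← Finset.mul_sum]
  calc _ ≤ C * M ^ (-b) * ((1 + 2 ^ (b - 1) / (b - 1)) * M) := by
        gcongr
        exact sum_min_rpow_le hb hM d
    _ = C * (1 + 2 ^ (b - 1) / (b - 1)) * (M ^ (-b) * M ^ (1 : ℝ)) := by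
        rw [Real.rpow_one]; ring
    _ = _ := by rw [← Real.rpow_add hM]; congr 2; ring

/-! ### The objective in the eigenbasis of the Hessian -/

namespace Problem

variable {d : ℕ} (P : Problem d)

lemma objective_eq (w : Vec d) :
    P.objective w = (1 / 2) * (w ⬝ᵥ (P.hessian *ᵥ w)) - P.linearTerm ⬝ᵥ w := by
  have h1 : ∀ i j, Integrable (fun z : Obs d => w i * (z.1 i j * w j)) P.law := fun i j =>
    ((P.integrable_H i j).mul_const _).const_mul _
  have h2 : ∀ i, Integrable (fun z : Obs d => z.2 i * w i) P.law := fun i =>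
    (P.integrable_b i).mul_const _
  have e : P.objective w = ∫ z, ((1 / 2) * ∑ i, ∑ j, w i * (z.1 i j * w j)
      - ∑ i, z.2 i * w i) ∂P.law := by
    refine integral_congr_ae (Filter.Eventually.of_forall fun z => ?_)
    simp only [sampleLoss, dotProduct, mulVec, Finset.mul_sum]
  rw [e, integral_sub ((integrable_finsetSum _ fun i _ => integrable_finsetSum _ fun j _ =>
    h1 i j).const_mul _) (integrable_finsetSum _ fun i _ => h2 i), integral_const_mul,
    integral_finsetSum _ fun i _ => integrable_finsetSum _ fun j _ => h1 i j,
    integral_finsetSum _ fun i _ => h2 i]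
  congr 1
  · congr 1
    simp only [dotProduct, mulVec, Finset.mul_sum]
    refine Finset.sum_congr rfl fun i _ => ?_
    rw [integral_finsetSum _ fun j _ => h1 i j]
    refine Finset.sum_congr rfl fun j _ => ?_
    rw [integral_const_mul, integral_mul_const]
    rfl
  · simp only [dotProduct]
    refine Finset.sum_congr rfl fun i _ => ?_
    rw [integral_mul_const]
    rfl

variable {P} {V : Matrix (Fin d) (Fin d) ℝ} {lam : Fin d → ℝ}

lemma IsEigensystem.dotProduct_hessian (h : P.IsEigensystem V lam) (v w : Vec d) :
    v ⬝ᵥ (P.hessian *ᵥ w) = ∑ i, lam i * ((Vᵀ *ᵥ v) i * (Vᵀ *ᵥ w) i) := by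
  rw [h.hessian_eq, ← mulVec_mulVec, ← mulVec_mulVec, dotProduct_mulVec, ← mulVec_transpose]
  simp only [dotProduct, mulVec_diagonal]
  exact Finset.sum_congr rfl fun i _ => by ring

lemma IsEigensystem.transpose_mul (h : P.IsEigensystem V lam) : Vᵀ * V = 1 := by
  have := h.orthogonal
  rw [Matrix.mem_orthogonalGroup_iff'] at this
  simpa [star_eq_conjTranspose, conjTranspose_eq_transpose_of_trivial] using this

lemma IsEigensystem.transpose_hessian_mulVec (h : P.IsEigensystem V lam) (w : Vec d) (i : Fin d) :
    (Vᵀ *ᵥ (P.hessian *ᵥ w)) i = lam i * (Vᵀ *ᵥ w) i := by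
  rw [h.hessian_eq, ← mulVec_mulVec, ← mulVec_mulVec, mulVec_mulVec _ Vᵀ V, h.transpose_mul,
    one_mulVec, mulVec_diagonal]

lemma IsEigensystem.column_quadratic (h : P.IsEigensystem V lam) (i : Fin d) :
    (fun j => V j i) ⬝ᵥ (P.hessian *ᵥ fun j => V j i) = lam i := by
  have e : ∀ k, (Vᵀ *ᵥ fun j => V j i) k = if k = i then 1 else 0 := by
    intro k
    have := congrFun (congrFun h.transpose_mul k) i
    rw [Matrix.one_apply] at this
    rw [← this]; rfl
  rw [h.dotProduct_hessian]
  simp [e]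

/-- A minimizer solves the normal equation. -/
lemma IsEigensystem.hessian_mulVec_minimizer (h : P.IsEigensystem V lam) {w₀ : Vec d}
    (hmin : ∀ w, P.objective w₀ ≤ P.objective w) : P.hessian *ᵥ w₀ = P.linearTerm := by
  have hsymm : ∀ v w : Vec d, v ⬝ᵥ (P.hessian *ᵥ w) = w ⬝ᵥ (P.hessian *ᵥ v) := fun v w => by
    rw [h.dotProduct_hessian, h.dotProduct_hessian]
    exact Finset.sum_congr rfl fun i _ => by ring
  have key : ∀ v : Vec d, v ⬝ᵥ (P.hessian *ᵥ w₀ - P.linearTerm) = 0 := by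
    intro v
    set g := v ⬝ᵥ (P.hessian *ᵥ w₀ - P.linearTerm) with hg
    have hexp : ∀ t : ℝ, P.objective (w₀ + t • v) - P.objective w₀
        = t * g + t ^ 2 * (1 / 2 * (v ⬝ᵥ (P.hessian *ᵥ v))) := by
      intro t
      rw [objective_eq, objective_eq, hg]
      simp only [mulVec_add, mulVec_smul, add_dotProduct, dotProduct_add, smul_dotProduct,
        dotProduct_smul, smul_eq_mul, dotProduct_sub, hsymm w₀ v, dotProduct_comm P.linearTerm v]
      ring
    set c := 1 / 2 * (v ⬝ᵥ (P.hessian *ᵥ v))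
    have hpos : ∀ t : ℝ, 0 ≤ t * g + t ^ 2 * c := fun t => by
      rw [← hexp]; linarith [hmin (w₀ + t • v)]
    -- A nonnegative quadratic without constant term has discriminant `g² ≤ 0`.
    have hd : discrim c g 0 ≤ 0 := discrim_le_zero fun t => by linarith [hpos t]
    rw [discrim] at hd
    nlinarith
  have := key (P.hessian *ᵥ w₀ - P.linearTerm)
  rw [dotProduct_self_eq_zero] at this
  exact sub_eq_zero.1 this

lemma IsEigensystem.objective_sub (h : P.IsEigensystem V lam) {w₀ : Vec d}
    (hw₀ : P.hessian *ᵥ w₀ = P.linearTerm) (w : Vec d) :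
    P.objective w = P.objective w₀ + 1 / 2 * ∑ i, lam i * (Vᵀ *ᵥ (w - w₀)) i ^ 2 := by
  rw [objective_eq, objective_eq, ← hw₀, dotProduct_comm _ w, dotProduct_comm _ w₀]
  simp only [h.dotProduct_hessian, mulVec_sub, Pi.sub_apply]
  rw [Finset.mul_sum, Finset.mul_sum, Finset.mul_sum, ← Finset.sum_sub_distrib,
    ← Finset.sum_sub_distrib, ← Finset.sum_add_distrib]
  exact Finset.sum_congr rfl fun i _ => by ring

lemma iInf_objective {w₀ : Vec d} (hmin : ∀ w, P.objective w₀ ≤ P.objective w) :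
    ⨅ w, P.objective w = P.objective w₀ :=
  le_antisymm (ciInf_le ⟨P.objective w₀, by rintro _ ⟨w, rfl⟩; exact hmin w⟩ w₀) (le_ciInf hmin)

end Problem

/-! ### The noise met along the run -/

section Run

variable {d : ℕ}

lemma measurable_matrix_entry (i j : Fin d) :
    Measurable fun A : Matrix (Fin d) (Fin d) ℝ => A i j :=
  (measurable_pi_apply (X := fun _ : Fin d => ℝ) j).comp
    (measurable_pi_apply (X := fun _ : Fin d => Fin d → ℝ) i)

lemma measurable_sampleGrad : Measurable fun p : Vec d × Obs d => sampleGrad p.1 p.2 := by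
  refine measurable_pi_lambda _ fun i => ?_
  simp only [sampleGrad, Pi.sub_apply, mulVec, dotProduct]
  refine (Finset.measurable_sum _ fun j _ => ?_).sub ?_
  · exact ((measurable_matrix_entry i j).comp measurable_snd.fst).mul
      ((measurable_pi_apply j).comp measurable_fst)
  · exact (measurable_pi_apply i).comp measurable_snd.snd

lemma measurable_mulVec_const (A : Matrix (Fin d) (Fin d) ℝ) :
    Measurable fun w : Vec d => A *ᵥ w := by
  refine measurable_pi_lambda _ fun i => ?_
  simp only [mulVec, dotProduct]
  exact Finset.measurable_sum _ fun j _ => (measurable_pi_apply j).const_mul _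

lemma measurable_uncurry_gradNoise (P : Problem d) :
    Measurable (Function.uncurry P.gradNoise) := by
  have : Measurable fun p : Vec d × Obs d => P.grad p.1 :=
    ((measurable_mulVec_const P.hessian).comp measurable_fst).sub_const _
  exact measurable_sampleGrad.sub this

lemma measurable_gradNoise (P : Problem d) {α : Type*} [MeasurableSpace α] {f : α → Vec d}
    {g : α → Obs d} (hf : Measurable f) (hg : Measurable g) :
    Measurable fun a => P.gradNoise (f a) (g a) := by
  have h : Measurable (Function.uncurry P.gradNoise ∘ fun a => (f a, g a)) :=
    (measurable_uncurry_gradNoise P).comp (hf.prodMk hg)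
  exact h

lemma measurable_dotProduct (v : Vec d) {α : Type*} [MeasurableSpace α] {f : α → Vec d}
    (hf : Measurable f) : Measurable fun a => v ⬝ᵥ f a := by
  simp only [dotProduct]
  exact Finset.measurable_sum _ fun j _ => ((measurable_pi_apply j).comp hf).const_mul _

lemma measurable_shbState (β η₀ : ℝ) (T t : ℕ) :
    Measurable fun z : ℕ → Obs d => shbState β η₀ T z t := by
  induction t with
  | zero => exact measurable_const
  | succ t ih =>
    have hg : Measurable fun z : ℕ → Obs d => sampleGrad (shbState β η₀ T z t).1 (z t) :=
      measurable_sampleGrad.comp (ih.fst.prodMk (measurable_pi_apply t))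
    have hu : Measurable fun z : ℕ → Obs d => β • (shbState β η₀ T z t).2
        + stepSize η₀ T t • sampleGrad (shbState β η₀ T z t).1 (z t) :=
      (ih.snd.const_smul β).add (hg.const_smul (stepSize η₀ T t))
    exact (ih.fst.sub hu).prodMk hu

/-- Adaptedness: this is what makes `w_t` independent of the observation used at step `t`. -/
lemma shbState_congr (β η₀ : ℝ) (T t : ℕ) {z z' : ℕ → Obs d} (h : ∀ s < t, z s = z' s) :
    shbState β η₀ T z t = shbState β η₀ T z' t := by
  induction t with
  | zero => rfl
  | succ t ih =>
    simp only [shbState, ih fun s hs => h s (hs.trans (Nat.lt_succ_self t)),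
      h t (Nat.lt_succ_self t)]

lemma integral_dotProduct_gradNoise (P : Problem d) (v w : Vec d) :
    ∫ z, v ⬝ᵥ P.gradNoise w z ∂P.law = 0 := by
  have h1 : ∀ i j, Integrable (fun z : Obs d => z.1 i j * w j) P.law := fun i j =>
    (P.integrable_H i j).mul_const _
  have h4 : ∀ i, Integrable (fun z : Obs d => ∑ j, z.1 i j * w j) P.law := fun i =>
    integrable_finsetSum _ fun j _ => h1 i j
  have h5 : ∀ i, Integrable (fun z : Obs d => ∑ j, z.1 i j * w j - z.2 i) P.law := fun i =>
    (h4 i).sub (P.integrable_b i)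
  have e : ∀ i, (fun z : Obs d => P.gradNoise w z i)
      = fun z : Obs d => (∑ j, z.1 i j * w j - z.2 i) - P.grad w i := fun i => rfl
  have h2 : ∀ i, Integrable (fun z : Obs d => P.gradNoise w z i) P.law := fun i => by
    rw [e]
    exact (h5 i).sub (integrable_const _)
  have h3 : ∀ i, ∫ z, P.gradNoise w z i ∂P.law = 0 := by
    intro i
    rw [e, integral_sub (h5 i) (integrable_const _), integral_sub (h4 i) (P.integrable_b i),
      integral_finsetSum _ fun j _ => h1 i j]
    simp only [integral_mul_const, integral_const, probReal_univ, one_smul]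
    exact sub_self _
  simp only [dotProduct]
  rw [integral_finsetSum _ fun i _ => (h2 i).const_mul _]
  simp [integral_const_mul, h3]

variable {Ω : Type*} {P : Problem d} {ξ : ℕ → Ω → Obs d}

/-- The coordinates of the run along an eigenvector follow the scalar heavy ball recursion. -/
lemma shbState_coord {V : Matrix (Fin d) (Fin d) ℝ} {lam : Fin d → ℝ}
    (hV : P.IsEigensystem V lam) {w₀ : Vec d} (hw₀ : P.hessian *ᵥ w₀ = P.linearTerm)
    (β η₀ : ℝ) (T : ℕ) (ω : Ω) (i : Fin d) (N : ℕ) :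
    (Vᵀ *ᵥ (shbIterate β η₀ T (fun s => ξ s ω) N - w₀)) i
      = (hbFlow β (stageRate (lam i * η₀) (stageLength T)) 0 (-(Vᵀ *ᵥ w₀) i, 0) N).1
        + ∑ s ∈ Finset.range N, (stepSize η₀ T s
          * (hbFlow β (stageRate (lam i * η₀) (stageLength T)) (s + 1) (-1, 1) (N - (s + 1))).1)
          * ((fun j => V j i) ⬝ᵥ runNoise P ξ β η₀ T s ω) := by
  set z : ℕ → Obs d := fun s => ξ s ω
  have hstep := hb_duhamel β (stageRate (lam i * η₀) (stageLength T))
    (fun s => stepSize η₀ T s * ((fun j => V j i) ⬝ᵥ runNoise P ξ β η₀ T s ω))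
    (fun t => ((Vᵀ *ᵥ ((shbState β η₀ T z t).1 - w₀)) i, (Vᵀ *ᵥ (shbState β η₀ T z t).2) i)) N
    (fun t _ => by
      have hg : sampleGrad (shbState β η₀ T z t).1 (z t)
          = P.hessian *ᵥ ((shbState β η₀ T z t).1 - w₀) + runNoise P ξ β η₀ T t ω := by
        simp only [runNoise, Problem.gradNoise, Problem.grad, mulVec_sub, hw₀, shbIterate, z]
        abel
      have hv : (Vᵀ *ᵥ runNoise P ξ β η₀ T t ω) i
          = (fun j => V j i) ⬝ᵥ runNoise P ξ β η₀ T t ω := rfl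
      have hq : stageRate (lam i * η₀) (stageLength T) t = lam i * stepSize η₀ T t := by
        simp only [stageRate, stepSize]; ring
      have hu : (Vᵀ *ᵥ (shbState β η₀ T z (t + 1)).2) i
          = β * (Vᵀ *ᵥ (shbState β η₀ T z t).2) i
            + stepSize η₀ T t * (lam i * (Vᵀ *ᵥ ((shbState β η₀ T z t).1 - w₀)) i
            + (fun j => V j i) ⬝ᵥ runNoise P ξ β η₀ T t ω) := by
        simp only [shbState, hg, mulVec_add, mulVec_smul, Pi.add_apply, Pi.smul_apply, smul_eq_mul,
          hV.transpose_hessian_mulVec, hv]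
      have hw : (Vᵀ *ᵥ ((shbState β η₀ T z (t + 1)).1 - w₀)) i
          = (Vᵀ *ᵥ ((shbState β η₀ T z t).1 - w₀)) i
            - (Vᵀ *ᵥ (shbState β η₀ T z (t + 1)).2) i := by
        simp only [shbState, mulVec_sub, Pi.sub_apply]; ring
      ext
      · simp only [hw, hu, hq, Prod.fst_add, hbStep_fst, Prod.smul_fst, smul_eq_mul]; ring
      · simp only [hu, hq, Prod.snd_add, hbStep_snd, Prod.smul_snd, smul_eq_mul]; ring)
  have h1 := congrArg Prod.fst hstep
  simp only [Prod.fst_add, Prod.fst_sum, Prod.smul_fst, smul_eq_mul] at h1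
  rw [shbIterate, h1]
  congr 1
  · simp [shbState, mulVec_neg]
  · exact Finset.sum_congr rfl fun s _ => by ring

variable [MeasurableSpace Ω] {μ : Measure Ω}

/-- The gradient noise is orthogonal to every function of the earlier observations. -/
lemma IsSample.integral_mul_runNoise [IsProbabilityMeasure μ] (h : IsSample P μ ξ) (β η₀ : ℝ)
    (T t : ℕ) (v : Vec d) {g : (ℕ → Obs d) → ℝ} (hg : Measurable g)
    (hgt : ∀ z z' : ℕ → Obs d, (∀ s < t, z s = z' s) → g z = g z')
    (hint : Integrable (fun ω => g (fun s => ξ s ω) * (v ⬝ᵥ runNoise P ξ β η₀ T t ω)) μ) :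
    ∫ ω, g (fun s => ξ s ω) * (v ⬝ᵥ runNoise P ξ β η₀ T t ω) ∂μ = 0 := by
  let past : Ω → (Finset.range t → Obs d) := fun ω i => ξ i ω
  have hpast : Measurable past := measurable_pi_lambda _ fun i => h.measurable i
  obtain ⟨ext, hext, hagree⟩ : ∃ ext : (Finset.range t → Obs d) → ℕ → Obs d,
      Measurable ext ∧ ∀ ω, ∀ s < t, ξ s ω = ext (past ω) s := by
    -- The value zero at times from `t` on is never read, because everything it is fed to depends
    -- only on times before `t`.
    refine ⟨fun x s => if hs : s ∈ Finset.range t then x ⟨s, hs⟩ else 0, ?_, ?_⟩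
    · refine measurable_pi_lambda _ fun s => ?_
      by_cases hs : s ∈ Finset.range t
      · simp only [hs, dite_true]; exact measurable_pi_apply _
      · simp only [hs, dite_false]; exact measurable_const
    · intro ω s hs
      simp [past, hs]
  let F : (Finset.range t → Obs d) × Obs d → ℝ := fun p =>
    g (ext p.1) * (v ⬝ᵥ P.gradNoise (shbIterate β η₀ T (ext p.1) t) p.2)
  have hF : Measurable F := by
    have hE : Measurable fun p : (Finset.range t → Obs d) × Obs d => ext p.1 :=
      hext.comp measurable_fst
    have hw : Measurable fun p : (Finset.range t → Obs d) × Obs d =>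
        shbIterate β η₀ T (ext p.1) t :=
      Measurable.comp (g := fun z => shbIterate β η₀ T z t) (measurable_shbState β η₀ T t).fst hE
    exact (hg.comp hE).mul (measurable_dotProduct v (measurable_gradNoise P hw measurable_snd))
  have hFe : (fun ω => g (fun s => ξ s ω) * (v ⬝ᵥ runNoise P ξ β η₀ T t ω))
      = fun ω => F (past ω, ξ t ω) := by
    funext ω
    simp only [F, runNoise, shbIterate]
    rw [hgt _ _ (hagree ω), shbState_congr β η₀ T t (hagree ω)]
  have hind : IndepFun past (ξ t) μ := by
    have h1 := h.indep.indepFun_finset (Finset.range t) {t} (by simp) h.measurable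
    exact h1.comp measurable_id
      (measurable_pi_apply (X := fun _ : ({t} : Finset ℕ) => Obs d) ⟨t, by simp⟩)
  have hmap : μ.map (fun ω => (past ω, ξ t ω)) = (μ.map past).prod P.law := by
    rw [← h.map_eq t]
    exact (indepFun_iff_map_prod_eq_prod_map_map hpast.aemeasurable
      (h.measurable t).aemeasurable).1 hind
  have hm : Measurable fun ω => (past ω, ξ t ω) := hpast.prodMk (h.measurable t)
  rw [hFe] at hint ⊢
  have hint' : Integrable F ((μ.map past).prod P.law) := by
    rw [← hmap, integrable_map_measure hF.aestronglyMeasurable hm.aemeasurable]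
    exact hint
  rw [← integral_map hm.aemeasurable (f := F) hF.aestronglyMeasurable, hmap]
  have := Measure.isProbabilityMeasure_map (μ := μ) hpast.aemeasurable
  rw [integral_prod _ hint']
  -- By Fubini the new observation is integrated first with the past frozen; the noise at a fixed
  -- point has mean zero.
  simp [F, integral_const_mul, integral_dotProduct_gradNoise]

lemma integrable_sq_add_orthogonal_sum [IsProbabilityMeasure μ] {N : ℕ} {X : ℕ → Ω → ℝ}
    (hX : ∀ t < N, MemLp (X t) 2 μ) (c : ℝ) (g : ℕ → ℝ) :
    Integrable (fun ω => (c + ∑ s ∈ Finset.range N, g s * X s ω) ^ 2) μ := by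
  have : MemLp (fun ω => c + ∑ s ∈ Finset.range N, g s * X s ω) 2 μ :=
    (memLp_const c).add (memLp_finsetSum _ fun s hs =>
      (hX s (Finset.mem_range.1 hs)).const_mul _)
  exact this.integrable_sq

/-- Second moment of a combination of centered and pairwise orthogonal random variables. -/
lemma integral_sq_add_orthogonal_sum_le [IsProbabilityMeasure μ] {N : ℕ} {X : ℕ → Ω → ℝ} {B : ℝ}
    (hX : ∀ t < N, MemLp (X t) 2 μ) (h0 : ∀ t < N, ∫ ω, X t ω ∂μ = 0)
    (hort : ∀ t < N, ∀ s < t, ∫ ω, X s ω * X t ω ∂μ = 0)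
    (hB : ∀ t < N, ∫ ω, X t ω ^ 2 ∂μ ≤ B) (c : ℝ) (g : ℕ → ℝ) :
    ∫ ω, (c + ∑ s ∈ Finset.range N, g s * X s ω) ^ 2 ∂μ
      ≤ c ^ 2 + B * ∑ s ∈ Finset.range N, g s ^ 2 := by
  induction N with
  | zero => simp
  | succ N ih =>
    have hX' : ∀ t < N, MemLp (X t) 2 μ := fun t ht => hX t (by omega)
    have hN := hX N (Nat.lt_succ_self N)
    have hS := ih hX' (fun t ht => h0 t (by omega)) (fun t ht => hort t (by omega))
      (fun t ht => hB t (by omega))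
    have i1 := integrable_sq_add_orthogonal_sum hX' c g
    have i2 : ∀ s ∈ Finset.range N, Integrable (fun ω => g s * (X s ω * X N ω)) μ := fun s hs =>
      ((hX' s (Finset.mem_range.1 hs)).integrable_mul hN).const_mul _
    have i3 : Integrable (fun ω => c * X N ω) μ := (hN.integrable (by norm_num)).const_mul c
    have i4 : Integrable (fun ω => g N ^ 2 * X N ω ^ 2) μ := hN.integrable_sq.const_mul _
    have e : ∀ ω, (c + ∑ s ∈ Finset.range (N + 1), g s * X s ω) ^ 2
        = (c + ∑ s ∈ Finset.range N, g s * X s ω) ^ 2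
          + (2 * g N) * (c * X N ω + ∑ s ∈ Finset.range N, g s * (X s ω * X N ω))
          + g N ^ 2 * X N ω ^ 2 := by
      intro ω
      rw [Finset.sum_range_succ]
      have : ∑ s ∈ Finset.range N, g s * (X s ω * X N ω)
          = (∑ s ∈ Finset.range N, g s * X s ω) * X N ω := by
        rw [Finset.sum_mul]; exact Finset.sum_congr rfl fun s _ => by ring
      rw [this]; ring
    simp only [e]
    have i5 : Integrable (fun ω => c * X N ω + ∑ s ∈ Finset.range N, g s * (X s ω * X N ω)) μ :=
      i3.add (integrable_finsetSum _ i2)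
    have z : ∫ ω, (c * X N ω + ∑ s ∈ Finset.range N, g s * (X s ω * X N ω)) ∂μ = 0 := by
      rw [integral_add i3 (integrable_finsetSum _ i2), integral_finsetSum _ i2, integral_const_mul,
        h0 N (Nat.lt_succ_self N), mul_zero, zero_add]
      refine Finset.sum_eq_zero fun s hs => ?_
      rw [integral_const_mul, hort N (Nat.lt_succ_self N) s (Finset.mem_range.1 hs), mul_zero]
    have i6 : Integrable (fun ω => (c + ∑ s ∈ Finset.range N, g s * X s ω) ^ 2
        + (2 * g N) * (c * X N ω + ∑ s ∈ Finset.range N, g s * (X s ω * X N ω))) μ :=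
      i1.add (i5.const_mul _)
    rw [integral_add i6 i4, integral_add i1 (i5.const_mul _),
      integral_const_mul, z, integral_const_mul, Finset.sum_range_succ]
    have := mul_le_mul_of_nonneg_left (hB N (Nat.lt_succ_self N)) (sq_nonneg (g N))
    linarith

lemma memLp_dotProduct {X : Ω → Vec d} (h : MemLp X 2 μ) (v : Vec d) :
    MemLp (fun ω => v ⬝ᵥ X ω) 2 μ := by
  simp only [dotProduct]
  refine memLp_finsetSum _ fun j _ => MemLp.const_mul ?_ _
  exact (memLp_pi_iff.1 h) j

lemma IsSample.integral_runNoise_sq_le [IsProbabilityMeasure μ] (h : IsSample P μ ξ)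
    {β η₀ σ : ℝ} {T t : ℕ} (hn : RunNoiseBoundedBy P μ ξ β η₀ T σ) (ht : t < totalSteps T)
    (v : Vec d) :
    ∫ ω, (v ⬝ᵥ runNoise P ξ β η₀ T t ω) ^ 2 ∂μ ≤ σ ^ 2 * (v ⬝ᵥ (P.hessian *ᵥ v)) := by
  have hm : Measurable fun ω => shbIterate β η₀ T (fun s => ξ s ω) t :=
    ((measurable_shbState β η₀ T t).comp (measurable_pi_lambda _ h.measurable)).fst
  rw [← integral_condExp hm.comap_le]
  refine (integral_mono_ae integrable_condExp (integrable_const _) ((hn t ht).2 v)).trans ?_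
  simp

/-- Bias and variance bound for the expected excess risk of the stochastic heavy ball method. -/
lemma expectedExcessLE_of_flow [IsProbabilityMeasure μ] {V : Matrix (Fin d) (Fin d) ℝ}
    {lam : Fin d → ℝ} (hV : P.IsEigensystem V lam) (hlam : ∀ i, 0 ≤ lam i) {w₀ : Vec d}
    (hmin : ∀ w, P.objective w₀ ≤ P.objective w) (h : IsSample P μ ξ) {β η₀ σ : ℝ} {T : ℕ}
    (hn : RunNoiseBoundedBy P μ ξ β η₀ T σ) {B : ℝ}
    (hB : 1 / 2 * ∑ i, (lam i * (hbFlow β (stageRate (lam i * η₀) (stageLength T)) 0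
        (-(Vᵀ *ᵥ w₀) i, 0) (totalSteps T)).1 ^ 2
      + σ ^ 2 * ∑ s ∈ Finset.range (totalSteps T), stageRate (lam i * η₀) (stageLength T) s ^ 2 *
        (hbFlow β (stageRate (lam i * η₀) (stageLength T)) (s + 1) (-1, 1)
          (totalSteps T - (s + 1))).1 ^ 2) ≤ B) :
    ExpectedExcessLE P μ ξ β η₀ T B := by
  have hw₀ := hV.hessian_mulVec_minimizer hmin
  set N := totalSteps T
  have hX : ∀ v : Vec d, ∀ t < N, MemLp (fun ω => v ⬝ᵥ runNoise P ξ β η₀ T t ω) 2 μ :=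
    fun v t ht => memLp_dotProduct (hn t ht).1 v
  have hrun : ∀ v : Vec d, ∀ s, Measurable fun z : ℕ → Obs d =>
      v ⬝ᵥ P.gradNoise (shbIterate β η₀ T z s) (z s) := fun v s =>
    measurable_dotProduct v (measurable_gradNoise P (measurable_shbState β η₀ T s).fst
      (measurable_pi_apply s))
  have h0 : ∀ v : Vec d, ∀ t < N, ∫ ω, v ⬝ᵥ runNoise P ξ β η₀ T t ω ∂μ = 0 := by
    intro v t ht
    have := h.integral_mul_runNoise β η₀ T t v (g := fun _ => 1) measurable_const
      (fun _ _ _ => rfl) (by simpa using (hX v t ht).integrable (by norm_num))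
    simpa using this
  have hort : ∀ v : Vec d, ∀ t < N, ∀ s < t, ∫ ω, (v ⬝ᵥ runNoise P ξ β η₀ T s ω)
      * (v ⬝ᵥ runNoise P ξ β η₀ T t ω) ∂μ = 0 := by
    intro v t ht s hs
    refine h.integral_mul_runNoise β η₀ T t v (hrun v s) (fun z z' hz => ?_)
      ((hX v s (hs.trans ht)).integrable_mul (hX v t ht))
    simp only [shbIterate]
    rw [shbState_congr β η₀ T s fun r hr => hz r (hr.trans hs), hz s hs]
  have hcoord := fun ω (i : Fin d) => shbState_coord (ξ := ξ) hV hw₀ β η₀ T ω i N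
  have hint : ∀ i, Integrable (fun ω =>
      lam i * (Vᵀ *ᵥ (shbIterate β η₀ T (fun s => ξ s ω) N - w₀)) i ^ 2) μ := by
    intro i
    simp only [hcoord]
    exact (integrable_sq_add_orthogonal_sum (hX _) _ _).const_mul _
  have hobj : ∀ ω, P.objective (shbOutput β η₀ T fun s => ξ s ω) = P.objective w₀
      + 1 / 2 * ∑ i, lam i * (Vᵀ *ᵥ (shbIterate β η₀ T (fun s => ξ s ω) N - w₀)) i ^ 2 :=
    fun ω => hV.objective_sub hw₀ _
  have hint2 := (integrable_finsetSum (μ := μ) Finset.univ fun i _ => hint i).const_mul (1 / 2)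
  refine ⟨?_, ?_⟩
  · simp only [hobj]
    exact (integrable_const _).add hint2
  · simp only [hobj]
    rw [integral_add (integrable_const _) hint2, integral_const_mul,
      integral_finsetSum _ fun i _ => hint i, Problem.iInf_objective hmin]
    simp only [integral_const, probReal_univ, one_smul, add_sub_cancel_left]
    refine le_trans ?_ hB
    gcongr with i
    rw [integral_const_mul]
    simp only [hcoord]
    have := integral_sq_add_orthogonal_sum_le (hX fun j => V j i) (h0 _) (hort _)
      (fun t ht => h.integral_runNoise_sq_le hn ht _)
      (hbFlow β (stageRate (lam i * η₀) (stageLength T)) 0 (-(Vᵀ *ᵥ w₀) i, 0) N).1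
      (fun s => stepSize η₀ T s
        * (hbFlow β (stageRate (lam i * η₀) (stageLength T)) (s + 1) (-1, 1) (N - (s + 1))).1)
    -- Along a unit eigenvector the noise has variance at most `σ²λᵢ`. Together with the weight `λᵢ`
    -- of the objective this turns `η_s²` into the squared rate `(λᵢη_s)²`.
    rw [hV.column_quadratic] at this
    refine (mul_le_mul_of_nonneg_left this (hlam i)).trans (le_of_eq ?_)
    rw [mul_add, Finset.mul_sum, Finset.mul_sum, Finset.mul_sum]
    congr 1
    refine Finset.sum_congr rfl fun s _ => ?_
    simp only [stageRate, stepSize]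
    ring

end Run

/-! ### Upper bounds -/

/-- Directions with `q₀ ≥ δ²` decay like `exp(-Kδ/2)`, which is below `1/T`; paying this term
everywhere allows one formula for all directions. -/
lemma StageRegime.exp_min_le {T n K : ℕ} {δ q₀ : ℝ} (R : StageRegime T n K δ q₀) :
    Real.exp (-(K * (min q₀ (δ ^ 2) / (2 * δ))))
      ≤ Real.exp (-(K * (q₀ / (2 * δ)))) + 1 / T := by
  have hT := R.T_pos
  have hδ := R.δ_pos
  rcases le_total q₀ (δ ^ 2) with h | h
  · rw [min_eq_left h]
    have : 0 < 1 / (T : ℝ) := by positivity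
    linarith
  · have hd : 128 * Real.log T ≤ K * δ := by
      rcases R.decay with hd | hd
      · rw [hd] at h; linarith [R.q_le]
      · exact hd
    rw [min_eq_right h]
    have h1 : δ ^ 2 / (2 * δ) = δ / 2 := by field_simp
    have hlog : 0 ≤ Real.log T := Real.log_nonneg (by linarith [R.T_ge'])
    have h2 : Real.exp (-(K * (δ ^ 2 / (2 * δ)))) ≤ 1 / T := by
      have e : 1 / (T : ℝ) = Real.exp (-Real.log T) := by
        rw [Real.exp_neg, Real.exp_log hT, one_div]
      rw [h1, e]
      exact Real.exp_le_exp.2 (by linarith)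
    linarith [Real.exp_pos (-(K * (q₀ / (2 * δ))))]

/-! ### Rounding of the number and length of stages -/

lemma numStages_pos {T : ℕ} (hT : 16 ≤ T) : 1 ≤ numStages T := Nat.log_pos (by norm_num) (by omega)

lemma numStages_le_logb (T : ℕ) : (numStages T : ℝ) ≤ Real.logb 2 T := by
  have := Real.natLog_le_logb T 2
  exact_mod_cast this

lemma one_le_logb {T : ℕ} (hT : 16 ≤ T) : 1 ≤ Real.logb 2 T :=
  le_trans (by exact_mod_cast numStages_pos hT) (numStages_le_logb T)

lemma log_le_logb {T : ℕ} (hT : 16 ≤ T) : Real.log T ≤ Real.logb 2 T := by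
  have h0 : 0 ≤ Real.log T := Real.log_nonneg (by exact_mod_cast (by omega : 1 ≤ T))
  have h2 := Real.log_two_lt_d9
  rw [Real.logb, le_div_iff₀ (Real.log_pos (by norm_num))]
  nlinarith

lemma stageLength_pos {T : ℕ} (hT : 16 ≤ T) : 1 ≤ stageLength T :=
  (Nat.one_le_div_iff (numStages_pos hT)).2 (Nat.log_le_self 2 T)

lemma stageLength_le (T : ℕ) : stageLength T ≤ T := Nat.div_le_self _ _

lemma le_two_mul_stageLength {T : ℕ} (hT : 16 ≤ T) :
    (T : ℝ) ≤ 2 * numStages T * stageLength T := by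
  have h1 : T < numStages T * (stageLength T + 1) :=
    Nat.lt_mul_div_succ T (numStages_pos hT)
  have h2 := stageLength_pos hT
  have : T ≤ 2 * numStages T * stageLength T := by nlinarith
  exact_mod_cast this

/-- The last step size is `η₀/4^(n-1)`, hence at most `16η₀/T²`. -/
lemma sq_le_four_pow_numStages (T : ℕ) : (T : ℝ) ^ 2 ≤ 4 * 4 ^ numStages T := by
  have h : T < 2 ^ (numStages T + 1) := Nat.lt_pow_succ_log_self (by norm_num) T
  have h1 : (T : ℝ) ≤ 2 ^ (numStages T + 1) := by exact_mod_cast h.le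
  refine (pow_le_pow_left₀ (Nat.cast_nonneg _) h1 2).trans (le_of_eq ?_)
  rw [← pow_mul, mul_comm, pow_mul, pow_succ]
  norm_num
  ring

/-! ### Summation over eigendirections and choice of parameters -/

/-- The excess risk of the stochastic heavy ball method with momentum `(1 - δ) ^ 2`, when the
effective progress `K λ₁ η₀ / δ` of a stage is `T ^ (a / b)` up to the factor `Y`. -/
lemma exists_shb_excess_le (a b c₁ c₂ c₃ : ℝ) (ha : 1 < a) (hb : 1 < b)
    (hc₁ : 0 < c₁) (hc₂ : 0 < c₂) (hc₃ : 0 < c₃) :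
    ∃ C : ℝ, 0 < C ∧ ∀ (d : ℕ) [NeZero d] (P : Problem d) (V : Matrix (Fin d) (Fin d) ℝ)
      (lam : Fin d → ℝ) (σ : ℝ) (T : ℕ) (β δ η₀ Y : ℝ)
      (Ω : Type*) [MeasurableSpace Ω] (μ : Measure Ω) [IsProbabilityMeasure μ]
      (ξ : ℕ → Ω → Obs d),
      P.IsEigensystem V lam → PowerLawSpectrum lam a c₁ c₂ → P.SourceCondition V lam b c₃ →
      16 ≤ T → β = (1 - δ) ^ 2 → δ ≤ 1 → 4 / (T : ℝ) ≤ δ →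
      (δ = 1 ∨ 128 * Real.log T ≤ stageLength T * δ) →
      0 ≤ lam 0 * η₀ → lam 0 * η₀ ≤ 1 / 2 → 1 ≤ Y →
      (T : ℝ) ^ (a / b) / Y ≤ stageLength T * (lam 0 * η₀) / δ →
      stageLength T * (lam 0 * η₀) / δ ≤ (T : ℝ) ^ (a / b) →
      IsSample P μ ξ → RunNoiseBoundedBy P μ ξ β η₀ T σ →
      ExpectedExcessLE P μ ξ β η₀ T (C * (Y ^ ((b - 1) / a) * (T : ℝ) ^ (-1 + 1 / b)
        + σ ^ 2 * Real.logb 2 T ^ 2 * (T : ℝ) ^ (-1 + 1 / b))) := by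
  set B₁ : ℝ := max 1 ((b / a / (c₁ / (2 * c₂))) ^ (b / a)) * (1 + 2 ^ (b - 1) / (b - 1)) with hB₁
  set B₂ : ℝ := 1 + 2 ^ (b - 1) / (b - 1) with hB₂
  set B₃ : ℝ := 1 + 2 ^ (2 * a - 1) / (2 * a - 1) with hB₃
  set ρ : ℝ := (c₂ / c₁) ^ (1 / a) with hρ
  have hb1 : 0 < b - 1 := by linarith
  have ha1 : 0 < 2 * a - 1 := by linarith
  have hB₂0 : 0 < B₂ := by positivity
  have hB₁0 : 0 < B₁ := mul_pos (lt_of_lt_of_le one_pos (le_max_left _ _)) hB₂0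
  have hB₃0 : 0 < B₃ := by positivity
  have hρ0 : 0 < ρ := by positivity
  -- `B₁` bounds the exponentially damped bias, `B₂` the uniform `1/T` remainder, and `B₃` the
  -- variance; `576 = 2 * 288`, the 2 coming from the rounding in `n/K`.
  refine ⟨9 * c₃ * (B₁ + B₂) + 576 * B₃ * ρ, by positivity, ?_⟩
  intro d _ P V lam σ T β δ η₀ Y Ω _ μ _ ξ hV hpow hsrc hT hβ hδ1 hδT hdec hq0 hq2 hY hlow hup
    hsam hnoise
  obtain ⟨w₀, hmin, hw₀⟩ := hsrc
  have hTpos : (0 : ℝ) < T := by exact_mod_cast (by omega : 0 < T)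
  have hT1 : (1 : ℝ) ≤ T := by exact_mod_cast (by omega : 1 ≤ T)
  have hδ0 : 0 < δ := (div_pos four_pos hTpos).trans_le hδT
  have hlam : ∀ i, 0 < lam i := fun i => lt_of_lt_of_le (by positivity) (hpow i).1
  have hlam0 := hlam 0
  have hl1 : c₁ ≤ lam 0 := by simpa using (hpow 0).1
  have hl2 : lam 0 ≤ c₂ := by simpa using (hpow 0).2
  have hη : 0 ≤ η₀ := nonneg_of_mul_nonneg_right hq0 hlam0
  set n := numStages T with hn
  set K := stageLength T with hK
  have hK0 : (0 : ℝ) < K := by exact_mod_cast stageLength_pos hT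
  have hlamle : ∀ i, lam i ≤ lam 0 := fun i => hV.antitone (Fin.zero_le _)
  have R : ∀ i, StageRegime T n K δ (lam i * η₀) := fun i =>
    { T_ge := hT
      n_pos := numStages_pos hT
      K_pos := stageLength_pos hT
      K_le := stageLength_le T
      T_sq_le := sq_le_four_pow_numStages T
      δ_le := hδ1
      δ_ge := hδT
      decay := hdec
      q_nonneg := mul_nonneg (hlam i).le hη
      q_le := (mul_le_mul_of_nonneg_right (hlamle i) hη).trans hq2 }
  set s : ℝ := K * (lam 0 * η₀) / δ with hs
  have hsi : ∀ i, K * (lam i * η₀) / δ = s * (lam i / lam 0) := fun i => by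
    rw [hs]; field_simp
  have hs0 : 0 ≤ s := by positivity
  have hrl : ∀ i : Fin d, c₁ / c₂ * ((i : ℝ) + 1) ^ (-a) ≤ lam i / lam 0 := fun i => by
    rw [le_div_iff₀ hlam0]
    calc c₁ / c₂ * ((i : ℝ) + 1) ^ (-a) * lam 0 ≤ c₁ / c₂ * ((i : ℝ) + 1) ^ (-a) * c₂ := by
          gcongr
      _ = c₁ * ((i : ℝ) + 1) ^ (-a) := by field_simp
      _ ≤ _ := (hpow i).1
  have hru : ∀ i : Fin d, lam i / lam 0 ≤ c₂ / c₁ * ((i : ℝ) + 1) ^ (-a) := fun i => by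
    rw [div_le_iff₀ hlam0]
    calc lam i ≤ c₂ * ((i : ℝ) + 1) ^ (-a) := (hpow i).2
      _ = c₂ / c₁ * ((i : ℝ) + 1) ^ (-a) * c₁ := by field_simp
      _ ≤ c₂ / c₁ * ((i : ℝ) + 1) ^ (-a) * lam 0 := by gcongr
  -- Cutoff index of the bias: `M₁^a` is the guaranteed progress `T^(a/b)/Y`.
  set M₁ : ℝ := (T : ℝ) ^ (1 / b) * Y ^ (-(1 / a)) with hM₁
  have hY0 : 0 < Y := by linarith
  have hM₁0 : 0 < M₁ := by positivity
  have hM₁a : M₁ ^ a = (T : ℝ) ^ (a / b) / Y := by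
    rw [hM₁, Real.mul_rpow (by positivity) (by positivity), ← Real.rpow_mul hTpos.le,
      ← Real.rpow_mul hY0.le, show -(1 / a) * a = -1 by field_simp, Real.rpow_neg_one,
      show 1 / b * a = a / b by ring, ← div_eq_mul_inv]
  -- Cutoff index of the variance, from the upper bound on the progress; `ρ` absorbs the ratio
  -- `c₂/c₁` of the spectral constants.
  set M : ℝ := (T : ℝ) ^ (1 / b) * ρ with hM
  have hM0 : 0 < M := by positivity
  have hMa : M ^ a = (T : ℝ) ^ (a / b) * (c₂ / c₁) := by
    rw [hM, Real.mul_rpow (by positivity) hρ0.le, ← Real.rpow_mul hTpos.le, hρ,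
      ← Real.rpow_mul (by positivity), show 1 / a * a = 1 by field_simp, Real.rpow_one,
      show 1 / b * a = a / b by ring]
  have hscale : ∀ (i : Fin d) {N : ℝ}, 0 < N →
      (((i : ℝ) + 1) / N) ^ (-a) = ((i : ℝ) + 1) ^ (-a) * N ^ a := fun i N hN => by
    rw [Real.div_rpow (by positivity) hN.le, Real.rpow_neg hN.le, div_inv_eq_mul]
  have hTb : (T : ℝ) ^ (-1 + 1 / b) = (T : ℝ) ^ (1 / b) / T := by
    rw [Real.rpow_add hTpos, Real.rpow_neg_one]; ring
  -- the bias
  have hbias : ∀ i : Fin d, lam i * (hbFlow β (stageRate (lam i * η₀) K) 0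
      (-(Vᵀ *ᵥ w₀) i, 0) (totalSteps T)).1 ^ 2
      ≤ 9 * c₃ * (((i : ℝ) + 1) ^ (-b)
          * Real.exp (-(c₁ / (2 * c₂) * (((i : ℝ) + 1) / M₁) ^ (-a)))
        + ((i : ℝ) + 1) ^ (-b) * (1 / T)) := by
    intro i
    have h1 := (R i).bias_sq_le (-(Vᵀ *ᵥ w₀) i)
    rw [neg_sq] at h1
    have h2 := (R i).exp_min_le
    have h3 : Real.exp (-(K * (lam i * η₀ / (2 * δ))))
        ≤ Real.exp (-(c₁ / (2 * c₂) * (((i : ℝ) + 1) / M₁) ^ (-a))) := by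
      refine Real.exp_le_exp.2 (neg_le_neg ?_)
      have e : K * (lam i * η₀ / (2 * δ)) = s * (lam i / lam 0) / 2 := by rw [← hsi]; ring
      rw [e, hscale i hM₁0, hM₁a]
      calc c₁ / (2 * c₂) * (((i : ℝ) + 1) ^ (-a) * ((T : ℝ) ^ (a / b) / Y))
          = (T : ℝ) ^ (a / b) / Y * (c₁ / c₂ * ((i : ℝ) + 1) ^ (-a)) / 2 := by field_simp
        _ ≤ s * (lam i / lam 0) / 2 := by gcongr; exact hrl i
    calc lam i * (hbFlow β (stageRate (lam i * η₀) K) 0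
          (-(Vᵀ *ᵥ w₀) i, 0) (totalSteps T)).1 ^ 2
        ≤ lam i * (9 * Real.exp (-(K * (min (lam i * η₀) (δ ^ 2) / (2 * δ))))
          * (Vᵀ *ᵥ w₀) i ^ 2) := by
          rw [hβ]
          exact mul_le_mul_of_nonneg_left h1 (hlam i).le
      _ = 9 * Real.exp (-(K * (min (lam i * η₀) (δ ^ 2) / (2 * δ))))
          * (lam i * (Vᵀ *ᵥ w₀) i ^ 2) := by ring
      _ ≤ 9 * (Real.exp (-(c₁ / (2 * c₂) * (((i : ℝ) + 1) / M₁) ^ (-a))) + 1 / T)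
          * (c₃ * ((i : ℝ) + 1) ^ (-b)) := by
          refine mul_le_mul ?_ (hw₀ i) (mul_nonneg (hlam i).le (sq_nonneg _)) (by positivity)
          exact mul_le_mul_of_nonneg_left (h2.trans (add_le_add h3 le_rfl)) (by norm_num)
      _ = _ := by ring
  have hbias_sum : ∑ i, lam i * (hbFlow β (stageRate (lam i * η₀) K) 0
      (-(Vᵀ *ᵥ w₀) i, 0) (totalSteps T)).1 ^ 2
      ≤ 9 * c₃ * (B₁ + B₂) * (Y ^ ((b - 1) / a) * (T : ℝ) ^ (-1 + 1 / b)) := by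
    refine (Finset.sum_le_sum fun i _ => hbias i).trans ?_
    rw [← Finset.mul_sum, Finset.sum_add_distrib, ← Finset.sum_mul]
    have e1 := sum_rpow_mul_exp_le (a := a) (b := b) (κ := c₁ / (2 * c₂)) (by linarith) hb
      (by positivity) hM₁0 d
    rw [Finset.sum_range] at e1
    have e2 : ∑ i : Fin d, ((i : ℝ) + 1) ^ (-b) ≤ B₂ := by
      have := sum_min_rpow_le hb one_pos d
      rw [Finset.sum_range, mul_one] at this
      refine le_trans (le_of_eq (Finset.sum_congr rfl fun i _ => ?_)) this
      rw [div_one, min_eq_right]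
      exact Real.rpow_le_one_of_one_le_of_nonpos
        (by linarith [(Nat.cast_nonneg (i : ℕ) : (0 : ℝ) ≤ (i : ℕ))]) (by linarith)
    have e3 : M₁ ^ (1 - b) = Y ^ ((b - 1) / a) * (T : ℝ) ^ (-1 + 1 / b) := by
      rw [hM₁, Real.mul_rpow (by positivity) (by positivity), ← Real.rpow_mul hTpos.le,
        ← Real.rpow_mul hY0.le, mul_comm]
      congr 2
      · ring
      · field_simp; ring
    have e4 : 1 / (T : ℝ) ≤ Y ^ ((b - 1) / a) * (T : ℝ) ^ (-1 + 1 / b) := by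
      rw [hTb]
      have h1 : 1 ≤ Y ^ ((b - 1) / a) := Real.one_le_rpow hY (by positivity)
      have h2 : 1 ≤ (T : ℝ) ^ (1 / b) := Real.one_le_rpow hT1 (by positivity)
      calc 1 / (T : ℝ) = 1 * (1 / T) := by ring
        _ ≤ Y ^ ((b - 1) / a) * ((T : ℝ) ^ (1 / b) / T) := by gcongr
    rw [e3] at e1
    set Z := Y ^ ((b - 1) / a) * (T : ℝ) ^ (-1 + 1 / b)
    calc _ ≤ 9 * c₃ * (B₁ * Z + B₂ * Z) := by
          gcongr
      _ = _ := by ring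
  -- the variance
  have hvar : ∀ i : Fin d, ∑ t ∈ Finset.range (totalSteps T), stageRate (lam i * η₀) K t ^ 2 *
        (hbFlow β (stageRate (lam i * η₀) K) (t + 1) (-1, 1) (totalSteps T - (t + 1))).1 ^ 2
      ≤ 288 * (n / K) * min 1 ((((i : ℝ) + 1) / M) ^ (-(2 * a))) := by
    intro i
    have h1 := (R i).variance_sum_le
    rw [← hβ] at h1
    refine h1.trans ?_
    have h2 : K * (lam i * η₀ / (4 * δ)) ≤ (((i : ℝ) + 1) / M) ^ (-a) := by
      have e : K * (lam i * η₀ / (4 * δ)) = s * (lam i / lam 0) / 4 := by rw [← hsi]; ring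
      rw [e, hscale i hM0, hMa]
      have h4 : s * (lam i / lam 0) ≤ (T : ℝ) ^ (a / b) * (c₂ / c₁ * ((i : ℝ) + 1) ^ (-a)) :=
        mul_le_mul hup (hru i) (div_nonneg (hlam i).le hlam0.le) (by positivity)
      have h5 : 0 ≤ s * (lam i / lam 0) := mul_nonneg hs0 (div_nonneg (hlam i).le hlam0.le)
      calc s * (lam i / lam 0) / 4 ≤ s * (lam i / lam 0) := by linarith
        _ ≤ _ := h4
        _ = _ := by ring
    have h3 : (K * (lam i * η₀ / (4 * δ))) ^ 2 ≤ (((i : ℝ) + 1) / M) ^ (-(2 * a)) := by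
      have h0 : 0 ≤ K * (lam i * η₀ / (4 * δ)) := by have := (hlam i).le; positivity
      refine (pow_le_pow_left₀ h0 h2 2).trans (le_of_eq ?_)
      rw [← Real.rpow_natCast, ← Real.rpow_mul (by positivity)]
      congr 1; push_cast; ring
    calc (n : ℝ) * (288 * (min 1 ((K * (lam i * η₀ / (4 * δ))) ^ 2) / K))
        = 288 * (n / K) * min 1 ((K * (lam i * η₀ / (4 * δ))) ^ 2) := by ring
      _ ≤ _ := by gcongr
  have hvar_sum : ∑ i : Fin d, ∑ t ∈ Finset.range (totalSteps T),
      stageRate (lam i * η₀) K t ^ 2 *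
        (hbFlow β (stageRate (lam i * η₀) K) (t + 1) (-1, 1) (totalSteps T - (t + 1))).1 ^ 2
      ≤ 576 * B₃ * ρ * (Real.logb 2 T ^ 2 * (T : ℝ) ^ (-1 + 1 / b)) := by
    refine (Finset.sum_le_sum fun i _ => hvar i).trans ?_
    rw [← Finset.mul_sum]
    have e1 := sum_min_rpow_le (s := 2 * a) (by linarith) hM0 d
    rw [Finset.sum_range] at e1
    have e2 : (n : ℝ) / K ≤ 2 * Real.logb 2 T ^ 2 / T := by
      rw [div_le_div_iff₀ hK0 hTpos]
      have h1 := le_two_mul_stageLength hT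
      have h2 := numStages_le_logb T
      calc (n : ℝ) * T ≤ n * (2 * n * K) := by gcongr
        _ = 2 * (n : ℝ) ^ 2 * K := by ring
        _ ≤ 2 * Real.logb 2 T ^ 2 * K := by gcongr
    have e3 : 0 ≤ 2 * Real.logb 2 T ^ 2 / (T : ℝ) :=
      div_nonneg (mul_nonneg two_pos.le (sq_nonneg _)) hTpos.le
    calc _ ≤ 288 * (2 * Real.logb 2 T ^ 2 / T) * (B₃ * M) :=
          mul_le_mul (mul_le_mul_of_nonneg_left e2 (by norm_num)) e1
            (Finset.sum_nonneg fun i _ => le_min zero_le_one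
              (Real.rpow_nonneg (div_nonneg (by positivity) hM0.le) _))
            (mul_nonneg (by norm_num) e3)
      _ = _ := by rw [hTb, hM]; ring
  refine expectedExcessLE_of_flow hV (fun i => (hlam i).le) hmin hsam hnoise ?_
  rw [Finset.sum_add_distrib, ← Finset.mul_sum]
  set Z := (T : ℝ) ^ (-1 + 1 / b)
  have hZ : 0 ≤ Z := by positivity
  have f1 : 0 ≤ Y ^ ((b - 1) / a) * Z := by positivity
  have f2 : 0 ≤ Real.logb 2 T ^ 2 * Z := by positivity
  have f3 := mul_le_mul_of_nonneg_left hvar_sum (sq_nonneg σ)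
  have f4 : 0 ≤ 9 * c₃ * (B₁ + B₂) := by positivity
  have f5 : 0 ≤ 576 * B₃ * ρ := by positivity
  generalize 9 * c₃ * (B₁ + B₂) = D₁ at *
  generalize 576 * B₃ * ρ = D₂ at *
  have g1 := mul_nonneg f4 f1
  have g2 := mul_nonneg f5 f1
  have g3 := mul_nonneg (mul_nonneg f4 f2) (sq_nonneg σ)
  have g4 := mul_nonneg (mul_nonneg f5 f2) (sq_nonneg σ)
  calc _ ≤ 1 / 2 * (D₁ * (Y ^ ((b - 1) / a) * Z)
        + σ ^ 2 * (D₂ * (Real.logb 2 T ^ 2 * Z))) :=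
          mul_le_mul_of_nonneg_left (add_le_add hbias_sum f3) (by norm_num)
    _ ≤ _ := by linarith

lemma ExpectedExcessLE.mono {d : ℕ} {Ω : Type*} [MeasurableSpace Ω] {P : Problem d}
    {μ : Measure Ω} {ξ : ℕ → Ω → Obs d} {β η₀ : ℝ} {T : ℕ} {B B' : ℝ}
    (h : ExpectedExcessLE P μ ξ β η₀ T B) (hB : B ≤ B') : ExpectedExcessLE P μ ξ β η₀ T B' :=
  ⟨h.1, h.2.trans hB⟩

/-- With `λ₁η₀ = 1/2`, the choice of `δ` makes the progress `K/(2δ)` equal to `T^(a/b)` times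
`K/(2AT)`, a power of a logarithm away from the target. -/
theorem heavyBall_upper_bound (a b c₁ c₂ c₃ : ℝ) (ha : 1 < a) (hb : 1 < b)
    (hc₁ : 0 < c₁) (hc₂ : 0 < c₂) (hc₃ : 0 < c₃) (hba : b < a) (hab : a ≤ 2 * b) :
    ∃ C : ℝ, 0 < C ∧
      ∀ (d : ℕ) [NeZero d] (P : Problem d) (V : Matrix (Fin d) (Fin d) ℝ)
        (lam : Fin d → ℝ) (σ : ℝ) (T : ℕ) (β η₀ : ℝ)
        (Ω : Type*) [MeasurableSpace Ω] (μ : Measure Ω) [IsProbabilityMeasure μ]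
        (ξ : ℕ → Ω → Obs d),
        P.IsEigensystem V lam → PowerLawSpectrum lam a c₁ c₂ →
        P.SourceCondition V lam b c₃ → 0 ≤ σ → 16 ≤ T →
        momentumConst T * (T : ℝ) ^ (-((a - b) / b)) ≤ 1 →
        β = (1 - momentumConst T * (T : ℝ) ^ (-((a - b) / b))) ^ 2 →
        η₀ = (2 * lam 0)⁻¹ →
        IsSample P μ ξ → RunNoiseBoundedBy P μ ξ β η₀ T σ →
        ExpectedExcessLE P μ ξ β η₀ T
          (C * (Real.logb 2 T ^ 6 * (T : ℝ) ^ (-1 + 1 / b)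
            + σ ^ 2 * Real.logb 2 T ^ 8 * (T : ℝ) ^ (-1 + 1 / b))) := by
  obtain ⟨C, hC, h⟩ := exists_shb_excess_le a b c₁ c₂ c₃ ha hb hc₁ hc₂ hc₃
  refine ⟨1024 * C, by positivity, ?_⟩
  intro d _ P V lam σ T β η₀ Ω _ μ _ ξ hV hpow hsrc _ hT hδ1 hβ hη hsam hnoise
  set δ := momentumConst T * (T : ℝ) ^ (-((a - b) / b)) with hδ
  have hT16 : (16 : ℝ) ≤ T := by exact_mod_cast hT
  have hTpos : (0 : ℝ) < T := by linarith
  have hlam0 : 0 < lam 0 := lt_of_lt_of_le (by positivity) (hpow 0).1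
  have hlη : lam 0 * η₀ = 1 / 2 := by rw [hη]; field_simp
  set L := Real.logb 2 T with hL
  have hL1 : 1 ≤ L := one_le_logb hT
  have hlogL : Real.log T ≤ L := log_le_logb hT
  have hlog1 : 1 ≤ Real.log T := by
    rw [Real.le_log_iff_exp_le hTpos]
    have := Real.exp_one_lt_d9
    linarith
  have hA : momentumConst T = 256 * L * Real.log T := rfl
  have hA0 : 0 < momentumConst T := by rw [hA]; positivity
  have hA256 : 256 ≤ momentumConst T := by
    rw [hA]; nlinarith [mul_le_mul hL1 hlog1 zero_le_one (by linarith)]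
  have hδ0 : 0 < δ := by positivity
  -- Here `a ≤ 2b` enters: `δ` is at least `A/T`. With `T ≤ 2LK` this yields exactly `Kδ ≥ 128 log
  -- T`.
  have hTδ : momentumConst T ≤ T * δ := by
    have h1 : (T : ℝ) ^ (-1 : ℝ) ≤ (T : ℝ) ^ (-((a - b) / b)) := by
      refine Real.rpow_le_rpow_of_exponent_le (by linarith) ?_
      rw [neg_le_neg_iff, div_le_one (by linarith)]
      linarith
    rw [Real.rpow_neg_one] at h1
    calc momentumConst T = T * (momentumConst T * (T : ℝ)⁻¹) := by field_simp
      _ ≤ _ := by rw [hδ]; gcongr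
  have hTab : (T : ℝ) ^ (a / b) * δ = momentumConst T * T := by
    rw [hδ, mul_left_comm, ← Real.rpow_add hTpos]
    have : a / b + -((a - b) / b) = 1 := by field_simp; ring
    rw [this, Real.rpow_one]
  have hTK : (T : ℝ) ≤ 2 * L * stageLength T := by
    refine (le_two_mul_stageLength hT).trans ?_
    have := numStages_le_logb T
    gcongr
  have hKT : (stageLength T : ℝ) ≤ T := by exact_mod_cast stageLength_le T
  -- The deficit is `2AT/K`, and `A ≤ 256L²`, `T ≤ 2LK` bound it by `1024L³`.
  have key := h d P V lam σ T β δ η₀ (1024 * L ^ 3) Ω μ ξ hV hpow hsrc hT hβ hδ1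
    (by rw [div_le_iff₀ hTpos]; linarith)
    (Or.inr (by
      have h1 : 2 * L * (128 * Real.log T) ≤ 2 * L * (stageLength T * δ) := by
        calc 2 * L * (128 * Real.log T) = momentumConst T := by rw [hA]; ring
          _ ≤ T * δ := hTδ
          _ ≤ 2 * L * stageLength T * δ := by gcongr
          _ = _ := by ring
      exact le_of_mul_le_mul_left h1 (by positivity)))
    (by rw [hlη]; norm_num) hlη.le
    (by nlinarith [one_le_pow₀ hL1 (n := 3)])
    (by
      rw [hlη, div_le_div_iff₀ (by positivity) hδ0, hTab, hA]
      calc 256 * L * Real.log T * T ≤ 256 * L * L * (2 * L * stageLength T) := by gcongr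
        _ = _ := by ring)
    (by
      rw [hlη, div_le_iff₀ hδ0, hTab]
      nlinarith)
    hsam hnoise
  refine key.mono ?_
  -- The exponent `(b - 1)/a` is below one because `b < a`.
  have hY : (1024 * L ^ 3) ^ ((b - 1) / a) ≤ 1024 * L ^ 6 := by
    have h3 : 1 ≤ L ^ 3 := one_le_pow₀ hL1
    calc (1024 * L ^ 3) ^ ((b - 1) / a) ≤ (1024 * L ^ 3) ^ (1 : ℝ) := by
          refine Real.rpow_le_rpow_of_exponent_le (by linarith) ?_
          rw [div_le_one (by linarith)]; linarith
      _ = 1024 * L ^ 3 := Real.rpow_one _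
      _ ≤ 1024 * L ^ 6 := by gcongr; norm_num
  have h8 : L ^ 2 ≤ 1024 * L ^ 8 := by
    have : L ^ 2 ≤ L ^ 8 := pow_le_pow_right₀ hL1 (by norm_num)
    linarith [pow_nonneg (zero_le_one.trans hL1) 8]
  calc C * ((1024 * L ^ 3) ^ ((b - 1) / a) * (T : ℝ) ^ (-1 + 1 / b)
        + σ ^ 2 * L ^ 2 * (T : ℝ) ^ (-1 + 1 / b))
      ≤ C * ((1024 * L ^ 6) * (T : ℝ) ^ (-1 + 1 / b)
        + σ ^ 2 * (1024 * L ^ 8) * (T : ℝ) ^ (-1 + 1 / b)) := by gcongr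
    _ = _ := by ring

/-- Here `δ = 1`, and the step size itself produces the progress `T^(a/b) * K/(2T)`, so `Y = 4L`.
The condition `a ≤ b` is what keeps `λ₁η₀ ≤ 1/2`. -/
theorem sgd_upper_bound (a b c₁ c₂ c₃ : ℝ) (ha : 1 < a) (hb : 1 < b)
    (hc₁ : 0 < c₁) (hc₂ : 0 < c₂) (hc₃ : 0 < c₃) (hab : a ≤ b) :
    ∃ C : ℝ, 0 < C ∧
      ∀ (d : ℕ) [NeZero d] (P : Problem d) (V : Matrix (Fin d) (Fin d) ℝ)
        (lam : Fin d → ℝ) (σ : ℝ) (T : ℕ) (η₀ : ℝ)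
        (Ω : Type*) [MeasurableSpace Ω] (μ : Measure Ω) [IsProbabilityMeasure μ]
        (ξ : ℕ → Ω → Obs d),
        P.IsEigensystem V lam → PowerLawSpectrum lam a c₁ c₂ →
        P.SourceCondition V lam b c₃ → 0 ≤ σ → 16 ≤ T →
        η₀ = 1 / (2 * lam 0) * (T : ℝ) ^ (-1 + a / b) →
        IsSample P μ ξ → RunNoiseBoundedBy P μ ξ 0 η₀ T σ →
        ExpectedExcessLE P μ ξ 0 η₀ T
          (C * (Real.logb 2 T ^ (2 * (b - 1) / a) * (T : ℝ) ^ (-1 + 1 / b)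
            + σ ^ 2 * Real.logb 2 T ^ 4 * (T : ℝ) ^ (-1 + 1 / b))) := by
  obtain ⟨C, hC, h⟩ := exists_shb_excess_le a b c₁ c₂ c₃ ha hb hc₁ hc₂ hc₃
  have he : 0 ≤ (b - 1) / a := div_nonneg (by linarith) (by linarith)
  refine ⟨4 ^ ((b - 1) / a) * C, by positivity, ?_⟩
  intro d _ P V lam σ T η₀ Ω _ μ _ ξ hV hpow hsrc _ hT hη hsam hnoise
  have hT16 : (16 : ℝ) ≤ T := by exact_mod_cast hT
  have hTpos : (0 : ℝ) < T := by linarith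
  have hlam0 : 0 < lam 0 := lt_of_lt_of_le (by positivity) (hpow 0).1
  have hlη : lam 0 * η₀ = 1 / 2 * (T : ℝ) ^ (-1 + a / b) := by rw [hη]; field_simp
  have hTab : (T : ℝ) ^ (-1 + a / b) = (T : ℝ) ^ (a / b) / T := by
    rw [Real.rpow_add hTpos, Real.rpow_neg_one]; ring
  set L := Real.logb 2 T with hL
  have hL1 : 1 ≤ L := one_le_logb hT
  have hTK : (T : ℝ) ≤ 2 * L * stageLength T := by
    refine (le_two_mul_stageLength hT).trans ?_
    have := numStages_le_logb T
    gcongr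
  have hKT : (stageLength T : ℝ) ≤ T := by exact_mod_cast stageLength_le T
  have hp : 0 < (T : ℝ) ^ (a / b) := by positivity
  have key := h d P V lam σ T 0 1 η₀ (4 * L) Ω μ ξ hV hpow hsrc hT (by norm_num) le_rfl
    (by rw [div_le_one hTpos]; linarith) (Or.inl rfl)
    (by rw [hlη]; positivity)
    (by
      rw [hlη]
      have : (T : ℝ) ^ (-1 + a / b) ≤ 1 := by
        refine Real.rpow_le_one_of_one_le_of_nonpos (by linarith) ?_
        have : a / b ≤ 1 := by rw [div_le_one (by linarith)]; exact hab
        linarith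
      linarith)
    (by linarith)
    (by
      rw [hlη, hTab, div_one, div_le_iff₀ (by positivity)]
      have h1 : 1 ≤ 2 * L * stageLength T / T := by rw [le_div_iff₀ hTpos]; linarith
      calc (T : ℝ) ^ (a / b) ≤ (T : ℝ) ^ (a / b) * (2 * L * stageLength T / T) :=
            le_mul_of_one_le_right hp.le h1
        _ = _ := by ring)
    (by
      rw [hlη, hTab, div_one]
      have h1 : (stageLength T : ℝ) / T ≤ 1 := by rw [div_le_one hTpos]; exact hKT
      calc (stageLength T : ℝ) * (1 / 2 * ((T : ℝ) ^ (a / b) / T))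
          = (T : ℝ) ^ (a / b) * (1 / 2 * (stageLength T / T)) := by ring
        _ ≤ (T : ℝ) ^ (a / b) := mul_le_of_le_one_right hp.le (by linarith))
    hsam hnoise
  refine key.mono ?_
  have h4 : (1 : ℝ) ≤ 4 ^ ((b - 1) / a) := Real.one_le_rpow (by norm_num) he
  have hY : (4 * L) ^ ((b - 1) / a) ≤ 4 ^ ((b - 1) / a) * L ^ (2 * (b - 1) / a) := by
    rw [Real.mul_rpow (by norm_num) (by linarith)]
    refine mul_le_mul_of_nonneg_left (Real.rpow_le_rpow_of_exponent_le hL1 ?_) (by positivity)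
    rw [mul_div_assoc]; linarith
  have h8 : L ^ 2 ≤ 4 ^ ((b - 1) / a) * L ^ 4 := by
    have h2 : L ^ 2 ≤ L ^ 4 := pow_le_pow_right₀ hL1 (by norm_num)
    exact h2.trans (le_mul_of_one_le_left (by positivity) h4)
  calc C * ((4 * L) ^ ((b - 1) / a) * (T : ℝ) ^ (-1 + 1 / b)
        + σ ^ 2 * L ^ 2 * (T : ℝ) ^ (-1 + 1 / b))
      ≤ C * ((4 ^ ((b - 1) / a) * L ^ (2 * (b - 1) / a)) * (T : ℝ) ^ (-1 + 1 / b)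
        + σ ^ 2 * (4 ^ ((b - 1) / a) * L ^ 4) * (T : ℝ) ^ (-1 + 1 / b)) := by gcongr
    _ = _ := by ring

/-! ### Lower bound: sign observations -/

/-- The sign of a bit. -/
def bitSign (x : Bool) : ℝ := if x then 1 else -1

lemma bitSign_sq (x : Bool) : bitSign x ^ 2 = 1 := by cases x <;> simp [bitSign]

lemma bitSign_not (x : Bool) : bitSign (!x) = -bitSign x := by cases x <;> simp [bitSign]

/-- Probability of the bit `x` when its sign has mean `e`. -/
def bitWeight (e : ℝ) (x : Bool) : ℝ := (1 + e * bitSign x) / 2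

lemma sum_bitWeight (e : ℝ) : ∑ x, bitWeight e x = 1 := by
  simp [bitWeight, bitSign]; ring

lemma bitWeight_pos {e : ℝ} (he : |e| < 1) (x : Bool) : 0 < bitWeight e x := by
  rw [abs_lt] at he
  cases x <;> simp [bitWeight, bitSign] <;> linarith

lemma bitWeight_mul_neg (e : ℝ) (x : Bool) :
    bitWeight e x * bitWeight (-e) x = (1 - e ^ 2) * bitWeight 0 x ^ 2 := by
  have := bitSign_sq x
  unfold bitWeight
  linear_combination (-e ^ 2 / 4) * this

section Likelihood

variable {d T : ℕ}

/-- Likelihood of `T` rounds of independent bits, the `i`-th one with sign of mean `e i`. -/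
def likelihood (e : Fin d → ℝ) (x : Fin T → Fin d → Bool) : ℝ := ∏ t, ∏ i, bitWeight (e i) (x t i)

lemma sum_likelihood (e : Fin d → ℝ) : ∑ x : Fin T → Fin d → Bool, likelihood e x = 1 := by
  have h1 : ∑ y : Fin d → Bool, ∏ i, bitWeight (e i) (y i) = 1 := by
    have := Finset.prod_univ_sum (fun _ : Fin d => (Finset.univ : Finset Bool))
      fun i x => bitWeight (e i) x
    rw [Fintype.piFinset_univ] at this
    rw [← this]
    exact Finset.prod_eq_one fun i _ => sum_bitWeight _
  have := Finset.prod_univ_sum (fun _ : Fin T => (Finset.univ : Finset (Fin d → Bool)))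
    fun _ y => ∏ i, bitWeight (e i) (y i)
  rw [Fintype.piFinset_univ] at this
  unfold likelihood
  rw [← this]
  simp [h1]

lemma likelihood_pos {e : Fin d → ℝ} (he : ∀ i, |e i| < 1) (x : Fin T → Fin d → Bool) :
    0 < likelihood e x :=
  Finset.prod_pos fun _ _ => Finset.prod_pos fun i _ => bitWeight_pos (he i) _

/-- An exact Hellinger-type identity: the geometric mean of the two hypotheses is a multiple of the
likelihood with coordinate `i` unbiased. It replaces an information inequality and tensorizes over
the rounds. -/
lemma likelihood_mul_flip (e : Fin d → ℝ) (i : Fin d) (x : Fin T → Fin d → Bool) :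
    likelihood e x * likelihood (Function.update e i (-e i)) x
      = (1 - e i ^ 2) ^ T * likelihood (Function.update e i 0) x ^ 2 := by
  have h : ∀ t, (∏ j, bitWeight (e j) (x t j))
      * ∏ j, bitWeight (Function.update e i (-e i) j) (x t j)
      = (1 - e i ^ 2) * (∏ j, bitWeight (Function.update e i 0 j) (x t j)) ^ 2 := by
    intro t
    have hc : (1 - e i ^ 2) = ∏ j : Fin d, if j = i then 1 - e i ^ 2 else 1 := by simp
    rw [hc, ← Finset.prod_mul_distrib, ← Finset.prod_pow, ← Finset.prod_mul_distrib]
    refine Finset.prod_congr rfl fun j _ => ?_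
    by_cases hj : j = i
    · subst hj
      simp [bitWeight_mul_neg]
    · simp [hj, pow_two]
  unfold likelihood
  rw [← Finset.prod_mul_distrib, ← Finset.prod_pow,
    show (1 - e i ^ 2) ^ T = ∏ _t : Fin T, (1 - e i ^ 2) by simp, ← Finset.prod_mul_distrib]
  exact Finset.prod_congr rfl fun t _ => h t

/-- Two-point testing bound, pointwise in the data. -/
lemma two_point_le {p q r κ u τ : ℝ} (hp : 0 < p) (hq : 0 < q) (hκ : 0 ≤ κ)
    (h : p * q = κ * r ^ 2) :
    4 * τ ^ 2 * κ * (r - (p + q) / 4) ≤ p * (u - τ) ^ 2 + q * (u + τ) ^ 2 := by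
  have hs : 0 < p + q := by positivity
  -- The left side is the minimum of the right side over `u`.
  have h1 : 4 * τ ^ 2 * (p * q) / (p + q) ≤ p * (u - τ) ^ 2 + q * (u + τ) ^ 2 := by
    rw [div_le_iff₀ hs]
    nlinarith [sq_nonneg ((p + q) * u - (p - q) * τ)]
  refine le_trans ?_ h1
  rw [h, le_div_iff₀ hs]
  -- Linearizing `r²/(p + q)` makes the bound summable over the data: `p`, `q` and `r` each have
  -- total mass one, so `r - (p + q)/4` sums to `1/2`.
  have h2 : (r - (p + q) / 4) * (p + q) ≤ r ^ 2 := by nlinarith [sq_nonneg (r - (p + q) / 2)]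
  calc 4 * τ ^ 2 * κ * (r - (p + q) / 4) * (p + q)
      = 4 * τ ^ 2 * κ * ((r - (p + q) / 4) * (p + q)) := by ring
    _ ≤ 4 * τ ^ 2 * κ * r ^ 2 := by gcongr
    _ = _ := by ring

lemma sum_two_point_le {e : Fin d → ℝ} (he : ∀ i, |e i| < 1) (i : Fin d) (σ : ℝ)
    (u : (Fin T → Fin d → Bool) → ℝ) :
    2 * (σ * e i) ^ 2 * (1 - e i ^ 2) ^ T
      ≤ ∑ x, likelihood e x * (u x - σ * e i) ^ 2
        + ∑ x, likelihood (Function.update e i (-e i)) x * (u x + σ * e i) ^ 2 := by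
  have hκ : 0 ≤ (1 - e i ^ 2) ^ T := by
    refine pow_nonneg ?_ T
    have := (sq_lt_one_iff_abs_lt_one (e i)).2 (he i)
    linarith
  have he' : ∀ j, |Function.update e i (-e i) j| < 1 := by
    intro j
    by_cases hj : j = i
    · subst hj; simpa using he j
    · simpa [hj] using he j
  rw [← Finset.sum_add_distrib]
  refine le_trans (le_of_eq ?_) (Finset.sum_le_sum fun x _ =>
    two_point_le (likelihood_pos he x) (likelihood_pos he' x) hκ (likelihood_mul_flip e i x))
  rw [← Finset.mul_sum, Finset.sum_sub_distrib, ← Finset.sum_div, Finset.sum_add_distrib,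
    sum_likelihood, sum_likelihood, sum_likelihood]
  ring

/-- The hypercube of mean vectors: `± ε` on `S`, with signs given by `r`, and zero elsewhere. -/
def cubeMean (S : Finset (Fin d)) (ε : ℝ) (r : Fin d → Bool) (i : Fin d) : ℝ :=
  if i ∈ S then ε * bitSign (r i) else 0

lemma cubeMean_sq_le (S : Finset (Fin d)) (ε : ℝ) (r : Fin d → Bool) (i : Fin d) :
    cubeMean S ε r i ^ 2 ≤ ε ^ 2 := by
  unfold cubeMean
  split_ifs
  · rw [mul_pow, bitSign_sq, mul_one]
  · simpa using sq_nonneg ε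

lemma cubeMean_flip {S : Finset (Fin d)} (ε : ℝ) (r : Fin d → Bool) {i : Fin d} :
    cubeMean S ε (Function.update r i (!r i))
      = Function.update (cubeMean S ε r) i (-cubeMean S ε r i) := by
  funext j
  by_cases hj : j = i
  · subst hj
    simp only [cubeMean, Function.update_self, bitSign_not]
    split_ifs <;> simp
  · simp [cubeMean, hj]

/-- Assouad's lemma for sign observations. -/
lemma assouad_sum_le (S : Finset (Fin d)) {ε : ℝ} (hε : ε ^ 2 < 1) (σ : ℝ)
    (u : (Fin T → Fin d → Bool) → Fin d → ℝ) :
    2 ^ d * (S.card * ((σ * ε) ^ 2 * (1 - ε ^ 2) ^ T))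
      ≤ ∑ r : Fin d → Bool, ∑ x, likelihood (cubeMean S ε r) x
        * ∑ i, (u x i - σ * cubeMean S ε r i) ^ 2 := by
  have habs : ∀ r i, |cubeMean S ε r i| < 1 := fun r i =>
    (sq_lt_one_iff_abs_lt_one _).1 ((cubeMean_sq_le S ε r i).trans_lt hε)
  set g : Fin d → (Fin d → Bool) → ℝ := fun i r =>
    ∑ x, likelihood (cubeMean S ε r) x * (u x i - σ * cubeMean S ε r i) ^ 2 with hg
  have hg0 : ∀ i r, 0 ≤ g i r := fun i r => Finset.sum_nonneg fun x _ =>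
    mul_nonneg (likelihood_pos (habs r) x).le (sq_nonneg _)
  have hone : ∀ i ∈ S, 2 ^ d * ((σ * ε) ^ 2 * (1 - ε ^ 2) ^ T) ≤ ∑ r, g i r := by
    intro i hi
    -- Flipping the `i`-th sign permutes the cube, so summing the two-point bound over all vertices
    -- counts each vertex twice.
    have hinv : Function.Involutive fun r : Fin d → Bool => Function.update r i (!r i) := by
      intro r
      funext j
      by_cases hj : j = i
      · subst hj; simp
      · simp [hj]
    have hflip : ∑ r, g i (Function.update r i (!r i)) = ∑ r, g i r :=
      Equiv.sum_comp hinv.toPerm (g i)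
    have hpair : ∀ r, 2 * ((σ * ε) ^ 2 * (1 - ε ^ 2) ^ T)
        ≤ g i r + g i (Function.update r i (!r i)) := by
      intro r
      have h1 := sum_two_point_le (T := T) (habs r) i σ fun x => u x i
      have h2 : cubeMean S ε r i ^ 2 = ε ^ 2 := by
        simp [cubeMean, hi, mul_pow, bitSign_sq]
      rw [mul_pow, h2, ← mul_pow] at h1
      simp only [hg, cubeMean_flip, Function.update_self]
      refine le_trans (le_of_eq (by ring)) (h1.trans (le_of_eq ?_))
      simp only [mul_neg, sub_neg_eq_add]
    have h3 := Finset.sum_le_sum fun r (_ : r ∈ Finset.univ) => hpair r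
    rw [Finset.sum_add_distrib, hflip, Finset.sum_const, Finset.card_univ, nsmul_eq_mul] at h3
    simp only [Fintype.card_pi, Fintype.card_bool, Finset.prod_const, Finset.card_univ,
      Fintype.card_fin] at h3
    push_cast at h3
    linarith
  calc 2 ^ d * (S.card * ((σ * ε) ^ 2 * (1 - ε ^ 2) ^ T))
      = ∑ _i ∈ S, 2 ^ d * ((σ * ε) ^ 2 * (1 - ε ^ 2) ^ T) := by
        rw [Finset.sum_const, nsmul_eq_mul]; ring
    _ ≤ ∑ i ∈ S, ∑ r, g i r := Finset.sum_le_sum hone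
    _ ≤ ∑ i, ∑ r, g i r := Finset.sum_le_sum_of_subset_of_nonneg (Finset.subset_univ _)
        fun i _ _ => Finset.sum_nonneg fun r _ => hg0 i r
    _ = _ := by
        rw [Finset.sum_comm]
        refine Finset.sum_congr rfl fun r _ => ?_
        rw [Finset.sum_comm]
        exact Finset.sum_congr rfl fun x _ => by rw [Finset.mul_sum]

end Likelihood

section SignProblems

/-! ### Lower bound: the problems -/

/-- The law of a bit whose sign has mean `e`. -/
def bitLaw (e : ℝ) : Measure Bool :=
  ENNReal.ofReal (bitWeight e true) • Measure.dirac true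
    + ENNReal.ofReal (bitWeight e false) • Measure.dirac false

lemma bitLaw_singleton (e : ℝ) (x : Bool) : bitLaw e {x} = ENNReal.ofReal (bitWeight e x) := by
  cases x <;> simp [bitLaw]

lemma isProbabilityMeasure_bitLaw {e : ℝ} (he : |e| < 1) : IsProbabilityMeasure (bitLaw e) := by
  refine ⟨?_⟩
  have h := sum_bitWeight e
  rw [Fintype.sum_bool] at h
  simp only [bitLaw, Measure.add_apply, Measure.smul_apply, measure_univ, smul_eq_mul, mul_one]
  rw [← ENNReal.ofReal_add (bitWeight_pos he _).le (bitWeight_pos he _).le, h, ENNReal.ofReal_one]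

lemma integral_bitLaw {e : ℝ} (he : |e| < 1) (f : Bool → ℝ) :
    ∫ x, f x ∂bitLaw e = bitWeight e true * f true + bitWeight e false * f false := by
  have := isProbabilityMeasure_bitLaw he
  rw [integral_fintype Integrable.of_finite, Fintype.sum_bool]
  simp only [Measure.real, bitLaw_singleton, smul_eq_mul,
    ENNReal.toReal_ofReal (bitWeight_pos he _).le]

variable {d : ℕ}

lemma measurable_obs_hessian (i j : Fin d) : Measurable fun z : Obs d => z.1 i j :=
  (measurable_matrix_entry i j).comp measurable_fst

lemma measurable_obs_linear (i : Fin d) : Measurable fun z : Obs d => z.2 i :=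
  (measurable_pi_apply i).comp measurable_snd

/-- The observation with Hessian `V diag(lam) Vᵀ` and signs `s` in the eigenbasis. -/
def signObs (V : Matrix (Fin d) (Fin d) ℝ) (lam : Fin d → ℝ) (σ : ℝ) (s : Fin d → Bool) : Obs d :=
  (V * Matrix.diagonal lam * Vᵀ, V *ᵥ fun i => √(lam i) * (σ * bitSign (s i)))

lemma measurable_signObs (V : Matrix (Fin d) (Fin d) ℝ) (lam : Fin d → ℝ) (σ : ℝ) :
    Measurable (signObs V lam σ) := measurable_of_finite _

/-- The problem with constant Hessian and independent sign noise of mean `e` in the eigenbasis. -/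
def signProblem (V : Matrix (Fin d) (Fin d) ℝ) (lam : Fin d → ℝ) (σ : ℝ) (e : Fin d → ℝ)
    (he : ∀ i, |e i| < 1) (hlam : ∀ i, 0 < lam i) : Problem d :=
  haveI := fun i => isProbabilityMeasure_bitLaw (he i)
  { law := (Measure.pi fun i => bitLaw (e i)).map (signObs V lam σ)
    prob := Measure.isProbabilityMeasure_map (measurable_signObs V lam σ).aemeasurable
    posSemidef := by
      have hmeas : MeasurableSet
          {z : Obs d | ∀ i j, z.1 i j = (V * Matrix.diagonal lam * Vᵀ) i j} := by
        simp only [Set.ofPred_forall]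
        exact MeasurableSet.iInter fun i => MeasurableSet.iInter fun j =>
          measurableSet_eq_fun (measurable_obs_hessian i j) measurable_const
      have hae : ∀ᵐ z ∂(Measure.pi fun i => bitLaw (e i)).map (signObs V lam σ),
          ∀ i j, z.1 i j = (V * Matrix.diagonal lam * Vᵀ) i j := by
        rw [ae_map_iff (measurable_signObs V lam σ).aemeasurable hmeas]
        exact Filter.Eventually.of_forall fun s i j => rfl
      filter_upwards [hae] with z hz
      have hz' : z.1 = V * Matrix.diagonal lam * Vᵀ := by ext i j; exact hz i j
      rw [hz']
      have := (Matrix.PosSemidef.diagonal fun i => (hlam i).le).mul_mul_conjTranspose_same V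
      rwa [conjTranspose_eq_transpose_of_trivial] at this
    integrable_H := fun i j => by
      exact (integrable_map_measure (measurable_obs_hessian i j).aestronglyMeasurable
        (measurable_signObs V lam σ).aemeasurable).2 Integrable.of_finite
    integrable_b := fun i => by
      exact (integrable_map_measure (measurable_obs_linear i).aestronglyMeasurable
        (measurable_signObs V lam σ).aemeasurable).2 Integrable.of_finite }

section SignProblem

variable {V : Matrix (Fin d) (Fin d) ℝ} {lam : Fin d → ℝ} {σ : ℝ} {e : Fin d → ℝ}
  (he : ∀ i, |e i| < 1) (hlam : ∀ i, 0 < lam i)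

lemma integral_signProblem {f : Obs d → ℝ} (hf : Measurable f) :
    ∫ z, f z ∂(signProblem V lam σ e he hlam).law
      = ∫ s, f (signObs V lam σ s) ∂Measure.pi fun i => bitLaw (e i) :=
  integral_map (measurable_signObs V lam σ).aemeasurable hf.aestronglyMeasurable

lemma hessian_signProblem :
    (signProblem V lam σ e he hlam).hessian = V * Matrix.diagonal lam * Vᵀ := by
  have := fun i => isProbabilityMeasure_bitLaw (he i)
  ext i j
  refine (integral_signProblem he hlam (measurable_obs_hessian i j)).trans ?_
  simp [signObs]

lemma linearTerm_signProblem :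
    (signProblem V lam σ e he hlam).linearTerm = V *ᵥ fun i => √(lam i) * (σ * e i) := by
  have := fun i => isProbabilityMeasure_bitLaw (he i)
  have hmean : ∀ i, ∫ s : Fin d → Bool, bitSign (s i) ∂(Measure.pi fun i => bitLaw (e i)) = e i := by
    intro i
    have h := measurePreserving_eval (fun i => bitLaw (e i)) i
    have h2 := integral_map (μ := Measure.pi fun i => bitLaw (e i)) h.measurable.aemeasurable
      (f := bitSign) (measurable_of_finite _).aestronglyMeasurable
    rw [h.map_eq] at h2
    rw [show (∫ s : Fin d → Bool, bitSign (s i) ∂(Measure.pi fun i => bitLaw (e i)))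
      = ∫ s, bitSign (Function.eval i s) ∂(Measure.pi fun i => bitLaw (e i)) from rfl, ← h2,
      integral_bitLaw (he i)]
    simp [bitWeight, bitSign]
    ring
  ext j
  refine (integral_signProblem he hlam (measurable_obs_linear j)).trans ?_
  simp only [signObs, mulVec, dotProduct]
  rw [integral_finsetSum _ fun i _ => Integrable.of_finite]
  refine Finset.sum_congr rfl fun i _ => ?_
  rw [integral_const_mul, integral_const_mul, integral_const_mul, hmean]

lemma isEigensystem_signProblem (hV : V ∈ Matrix.orthogonalGroup (Fin d) ℝ) (ha : Antitone lam) :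
    (signProblem V lam σ e he hlam).IsEigensystem V lam :=
  ⟨hV, hessian_signProblem he hlam, ha⟩

/-- The minimizer of the objective of `signProblem`. -/
def signMinimizer (V : Matrix (Fin d) (Fin d) ℝ) (lam : Fin d → ℝ) (σ : ℝ) (e : Fin d → ℝ) :
    Vec d := V *ᵥ fun i => σ * e i / √(lam i)

lemma transpose_mulVec_signMinimizer (hV : V ∈ Matrix.orthogonalGroup (Fin d) ℝ) (i : Fin d) :
    (Vᵀ *ᵥ signMinimizer V lam σ e) i = σ * e i / √(lam i) := by
  have h : Vᵀ * V = 1 := by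
    rw [Matrix.mem_orthogonalGroup_iff'] at hV
    simpa [star_eq_conjTranspose, conjTranspose_eq_transpose_of_trivial] using hV
  rw [signMinimizer, mulVec_mulVec, h, one_mulVec]

/-- In the coordinates `√λᵢ vᵢᵀw` the risk no longer involves the spectrum, which reduces
optimization to estimating the mean vector `σe`. -/
lemma objective_signProblem (hV : V ∈ Matrix.orthogonalGroup (Fin d) ℝ) (ha : Antitone lam)
    (w : Vec d) :
    (signProblem V lam σ e he hlam).objective w
      = (signProblem V lam σ e he hlam).objective (signMinimizer V lam σ e)
        + 1 / 2 * ∑ i, (√(lam i) * (Vᵀ *ᵥ w) i - σ * e i) ^ 2 := by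
  have hE := isEigensystem_signProblem (σ := σ) he hlam hV ha
  rw [hE.objective_sub (w₀ := signMinimizer V lam σ e)]
  · congr 2
    refine Finset.sum_congr rfl fun i _ => ?_
    have h0 : √(lam i) ≠ 0 := (Real.sqrt_pos.2 (hlam i)).ne'
    rw [mulVec_sub, Pi.sub_apply, transpose_mulVec_signMinimizer hV]
    nth_rewrite 1 [← Real.sq_sqrt (hlam i).le]
    field_simp
  · rw [linearTerm_signProblem, hessian_signProblem, ← mulVec_mulVec, ← mulVec_mulVec]
    congr 1
    funext i
    rw [mulVec_diagonal, transpose_mulVec_signMinimizer hV]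
    have h0 : √(lam i) ≠ 0 := (Real.sqrt_pos.2 (hlam i)).ne'
    nth_rewrite 1 [← Real.sq_sqrt (hlam i).le]
    field_simp

lemma objective_signMinimizer_le (hV : V ∈ Matrix.orthogonalGroup (Fin d) ℝ) (ha : Antitone lam)
    (w : Vec d) :
    (signProblem V lam σ e he hlam).objective (signMinimizer V lam σ e)
      ≤ (signProblem V lam σ e he hlam).objective w := by
  rw [objective_signProblem he hlam hV ha w]
  have : 0 ≤ ∑ i, (√(lam i) * (Vᵀ *ᵥ w) i - σ * e i) ^ 2 :=
    Finset.sum_nonneg fun i _ => sq_nonneg _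
  linarith

lemma excessRisk_signProblem (hV : V ∈ Matrix.orthogonalGroup (Fin d) ℝ) (ha : Antitone lam)
    (w : Vec d) :
    (signProblem V lam σ e he hlam).excessRisk w
      = 1 / 2 * ∑ i, (√(lam i) * (Vᵀ *ᵥ w) i - σ * e i) ^ 2 := by
  rw [Problem.excessRisk, Problem.iInf_objective (objective_signMinimizer_le he hlam hV ha),
    objective_signProblem he hlam hV ha w, add_sub_cancel_left]

/-- The Hessian is deterministic, so the noise does not depend on `w`. Its coordinates in the
eigenbasis are independent with variances `σ²λᵢ(1 - eᵢ²) ≤ σ²λᵢ`. -/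
lemma noiseBoundedBy_signProblem (hV : V ∈ Matrix.orthogonalGroup (Fin d) ℝ)
    (ha : Antitone lam) : (signProblem V lam σ e he hlam).NoiseBoundedBy σ := by
  have := fun i => isProbabilityMeasure_bitLaw (he i)
  set P := signProblem V lam σ e he hlam with hP
  have hE : P.IsEigensystem V lam := isEigensystem_signProblem he hlam hV ha
  have hmeas : ∀ w, Measurable fun z => P.gradNoise w z := fun w =>
    measurable_gradNoise P measurable_const measurable_id
  intro w
  have hLp : MemLp (P.gradNoise w) 2 P.law := by
    have h := memLp_map_measure_iff (p := 2) (μ := Measure.pi fun i => bitLaw (e i))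
      (hmeas w).aestronglyMeasurable (measurable_signObs V lam σ).aemeasurable
    exact h.2 MemLp.of_discrete
  refine ⟨hLp, fun v => ?_⟩
  have hv : Measurable fun z => v ⬝ᵥ P.gradNoise w z := measurable_dotProduct v (hmeas w)
  rw [← variance_of_integral_eq_zero hv.aemeasurable (integral_dotProduct_gradNoise P v w)]
  have hvar : Var[fun z => v ⬝ᵥ P.gradNoise w z; P.law]
      = Var[fun s => v ⬝ᵥ P.gradNoise w (signObs V lam σ s); Measure.pi fun i => bitLaw (e i)] :=
    variance_map hv.aemeasurable (measurable_signObs V lam σ).aemeasurable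
  rw [hvar]
  have hform : (fun s => v ⬝ᵥ P.gradNoise w (signObs V lam σ s))
      = ∑ i, fun s : Fin d → Bool =>
        (Vᵀ *ᵥ v) i * √(lam i) * σ * (e i - bitSign (s i)) := by
    funext s
    have h1 : P.gradNoise w (signObs V lam σ s)
        = V *ᵥ fun i => √(lam i) * σ * (e i - bitSign (s i)) := by
      simp only [Problem.gradNoise, Problem.grad, sampleGrad, signObs, hP,
        hessian_signProblem, linearTerm_signProblem]
      rw [sub_sub_sub_cancel_left, ← mulVec_sub]
      congr 1
      funext i
      simp only [Pi.sub_apply]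
      ring
    rw [h1, dotProduct_mulVec, ← mulVec_transpose, Finset.sum_apply]
    exact Finset.sum_congr rfl fun i _ => by ring
  rw [hform, variance_sum_pi (X := fun i x => (Vᵀ *ᵥ v) i * √(lam i) * σ * (e i - bitSign x))
    fun i => MemLp.of_discrete, hE.dotProduct_hessian, Finset.mul_sum]
  refine Finset.sum_le_sum fun i _ => ?_
  refine (variance_le_expectation_sq (measurable_of_finite _).aestronglyMeasurable).trans ?_
  have h2 : ∫ x, ((fun x => (Vᵀ *ᵥ v) i * √(lam i) * σ * (e i - bitSign x)) ^ 2) x ∂bitLaw (e i)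
      = (1 - e i ^ 2) * (σ ^ 2 * (lam i * ((Vᵀ *ᵥ v) i * (Vᵀ *ᵥ v) i))) := by
    rw [integral_bitLaw (he i)]
    simp only [Pi.pow_apply, bitWeight, bitSign]
    nth_rewrite 3 [← Real.sq_sqrt (hlam i).le]
    simp
    ring
  rw [h2]
  refine mul_le_of_le_one_left ?_ (by linarith [sq_nonneg (e i)])
  have := (hlam i).le
  have := mul_self_nonneg ((Vᵀ *ᵥ v) i)
  positivity

end SignProblem

end SignProblems

section Minimax

/-! ### Lower bound: the minimax risk -/

variable {d T : ℕ}

lemma Algorithm.measurable_estimate (𝒜 : Algorithm d) (t : ℕ) (ht : t ≤ T) :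
    Measurable fun p : 𝒜.Seed × (Fin T → Obs d) => 𝒜.estimate p.1 p.2 t ht := by
  induction t using Nat.strong_induction_on with
  | _ t ih =>
    cases t with
    | zero =>
      simp only [Algorithm.estimate]
      exact measurable_const
    | succ t =>
      simp only [Algorithm.estimate]
      refine (𝒜.measurable_step (t + 1)).comp (measurable_fst.prodMk (Measurable.prodMk ?_ ?_))
      · exact measurable_pi_lambda _ fun i => (measurable_pi_apply _).comp measurable_snd
      · exact measurable_pi_lambda _ fun i => ih i.1 i.2 _

lemma Problem.measurable_excessRisk (P : Problem d) : Measurable P.excessRisk := by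
  have h : P.objective = fun w : Vec d => (1 / 2) * (∑ i, w i * ∑ j, P.hessian i j * w j)
      - ∑ i, P.linearTerm i * w i := by
    funext w
    rw [P.objective_eq]
    rfl
  have hm : Measurable P.objective := by
    rw [h]
    fun_prop
  exact hm.sub_const _

lemma pi_bitLaw_singleton {e : Fin d → ℝ} (he : ∀ i, |e i| < 1) (x : Fin T → Fin d → Bool) :
    (Measure.pi fun _ : Fin T => Measure.pi fun i => bitLaw (e i)) {x}
      = ENNReal.ofReal (likelihood e x) := by
  have := fun i => isProbabilityMeasure_bitLaw (he i)
  have hw := fun i x => (bitWeight_pos (he i) x).le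
  simp only [Measure.pi_singleton, bitLaw_singleton, likelihood]
  rw [ENNReal.ofReal_prod_of_nonneg fun t _ => Finset.prod_nonneg fun i _ => hw i _]
  exact Finset.prod_congr rfl fun t _ => (ENNReal.ofReal_prod_of_nonneg fun i _ => hw i _).symm

/-- The risk as an average over the seed of a likelihood-weighted finite sum. -/
lemma Algorithm.risk_signProblem (𝒜 : Algorithm d) {V : Matrix (Fin d) (Fin d) ℝ} {lam : Fin d → ℝ}
    {σ : ℝ} {e : Fin d → ℝ} (he : ∀ i, |e i| < 1) (hlam : ∀ i, 0 < lam i) :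
    ∃ Φ : 𝒜.Seed → ENNReal, Measurable Φ ∧
      𝒜.risk (signProblem V lam σ e he hlam) T = ∫⁻ s, Φ s ∂𝒜.seedLaw ∧
      ∀ s, Φ s = ∑ x : Fin T → Fin d → Bool,
        ENNReal.ofReal ((signProblem V lam σ e he hlam).excessRisk
          (𝒜.estimate s (fun t => signObs V lam σ (x t)) T le_rfl))
          * ENNReal.ofReal (likelihood e x) := by
  have := fun i => isProbabilityMeasure_bitLaw (he i)
  set P := signProblem V lam σ e he hlam with hP
  let f : 𝒜.Seed → (Fin T → Obs d) → ENNReal := fun s z =>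
    ENNReal.ofReal (P.excessRisk (𝒜.estimate s z T le_rfl))
  have hF : Measurable (Function.uncurry f) :=
    ENNReal.measurable_ofReal.comp
      (P.measurable_excessRisk.comp (𝒜.measurable_estimate T le_rfl))
  have hlaw : (Measure.pi fun _ : Fin T => P.law)
      = (Measure.pi fun _ : Fin T => Measure.pi fun i => bitLaw (e i)).map
        (fun x t => signObs V lam σ (x t)) := by
    have hs : ∀ _ : Fin T, SigmaFinite
        ((Measure.pi fun i => bitLaw (e i)).map (signObs V lam σ)) := fun _ => by
      have := Measure.isProbabilityMeasure_map (μ := Measure.pi fun i => bitLaw (e i))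
        (measurable_signObs V lam σ).aemeasurable
      infer_instance
    exact (Measure.pi_map_pi (μ := fun _ : Fin T => Measure.pi fun i => bitLaw (e i))
      (f := fun _ => signObs V lam σ) (hμ := hs)
      fun _ => (measurable_signObs V lam σ).aemeasurable).symm
  refine ⟨fun s => ∫⁻ z, f s z ∂(Measure.pi fun _ : Fin T => P.law), hF.lintegral_prod_right', ?_, fun s => ?_⟩
  · exact lintegral_prod _ hF.aemeasurable
  · simp only [hlaw]
    rw [lintegral_map hF.of_uncurry_left (measurable_of_finite _), lintegral_fintype]
    exact Finset.sum_congr rfl fun x _ => by rw [pi_bitLaw_singleton he]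

/-- Minimax lower bound over a hypercube of sign problems. -/
lemma le_minimaxRisk_of_cube {V : Matrix (Fin d) (Fin d) ℝ} {lam : Fin d → ℝ} {σ ε : ℝ}
    (hV : V ∈ Matrix.orthogonalGroup (Fin d) ℝ) (ha : Antitone lam) (hlam : ∀ i, 0 < lam i)
    (S : Finset (Fin d)) (hε : ε ^ 2 < 1) (𝓕 : Set (Problem d))
    (h𝓕 : ∀ (r : Fin d → Bool) (he : ∀ i, |cubeMean S ε r i| < 1),
      signProblem V lam σ (cubeMean S ε r) he hlam ∈ 𝓕) :
    ENNReal.ofReal (1 / 2 * (S.card * ((σ * ε) ^ 2 * (1 - ε ^ 2) ^ T))) ≤ minimaxRisk 𝓕 T := by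
  have habs : ∀ r i, |cubeMean S ε r i| < 1 := fun r i =>
    (sq_lt_one_iff_abs_lt_one _).1 ((cubeMean_sq_le S ε r i).trans_lt hε)
  refine le_iInf fun 𝒜 => ?_
  choose Φ hΦm hΦr hΦ using fun r =>
    𝒜.risk_signProblem (T := T) (V := V) (σ := σ) (habs r) hlam
  set B := 1 / 2 * (S.card * ((σ * ε) ^ 2 * (1 - ε ^ 2) ^ T)) with hB
  -- For a frozen seed the final estimate is a function of the data alone, whatever use was made of
  -- previous estimates, so Assouad's bound applies seed by seed.
  have hpoint : ∀ s, ENNReal.ofReal (2 ^ d * B) ≤ ∑ r, Φ r s := by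
    intro s
    have h1 := assouad_sum_le (T := T) S hε σ fun x i =>
      √(lam i) * (Vᵀ *ᵥ 𝒜.estimate s (fun t => signObs V lam σ (x t)) T le_rfl) i
    have h2 : ∀ r, Φ r s = ENNReal.ofReal (1 / 2 * ∑ x, likelihood (cubeMean S ε r) x
        * ∑ i, (√(lam i) * (Vᵀ *ᵥ 𝒜.estimate s (fun t => signObs V lam σ (x t)) T le_rfl) i
          - σ * cubeMean S ε r i) ^ 2) := by
      intro r
      rw [hΦ, Finset.mul_sum, ENNReal.ofReal_sum_of_nonneg]
      · refine Finset.sum_congr rfl fun x _ => ?_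
        rw [excessRisk_signProblem (habs r) hlam hV ha, ← ENNReal.ofReal_mul
          (mul_nonneg (by norm_num) (Finset.sum_nonneg fun i _ => sq_nonneg _))]
        congr 1
        ring
      · intro x _
        exact mul_nonneg (by norm_num) (mul_nonneg (likelihood_pos (habs r) x).le
          (Finset.sum_nonneg fun i _ => sq_nonneg _))
    simp only [h2]
    rw [← ENNReal.ofReal_sum_of_nonneg, ← Finset.mul_sum]
    · refine ENNReal.ofReal_le_ofReal ?_
      rw [hB]
      linarith
    · intro r _
      exact mul_nonneg (by norm_num) (Finset.sum_nonneg fun x _ =>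
        mul_nonneg (likelihood_pos (habs r) x).le (Finset.sum_nonneg fun i _ => sq_nonneg _))
  have hsum : ENNReal.ofReal (2 ^ d * B) ≤ ∑ r : Fin d → Bool,
      𝒜.risk (signProblem V lam σ (cubeMean S ε r) (habs r) hlam) T := by
    simp only [hΦr]
    rw [← lintegral_finsetSum _ fun r _ => hΦm r]
    calc ENNReal.ofReal (2 ^ d * B) = ∫⁻ _, ENNReal.ofReal (2 ^ d * B) ∂𝒜.seedLaw := by simp
      _ ≤ _ := lintegral_mono hpoint
  have hsup : ∀ r : Fin d → Bool,
      𝒜.risk (signProblem V lam σ (cubeMean S ε r) (habs r) hlam) T ≤ ⨆ P ∈ 𝓕, 𝒜.risk P T :=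
    fun r => le_iSup₂ (f := fun P (_ : P ∈ 𝓕) => 𝒜.risk P T) _ (h𝓕 r (habs r))
  have h3 := hsum.trans (Finset.sum_le_sum fun r _ => hsup r)
  rw [Finset.sum_const, Finset.card_univ, nsmul_eq_mul, ENNReal.ofReal_mul (by positivity)] at h3
  have hcard : ((Fintype.card (Fin d → Bool) : ℕ) : ENNReal) = ENNReal.ofReal (2 ^ d) := by
    rw [Fintype.card_pi]
    simp [ENNReal.ofReal_pow]
  rw [hcard] at h3
  exact (ENNReal.mul_le_mul_iff_right (by simp) ENNReal.ofReal_ne_top).1 h3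

/-- The number of perturbed coordinates is the largest the source condition allows at the
undetectable amplitude `σ²/T`: solving `i^(-b) = σ²/T` gives `Z`. -/
theorem minimax_lower_bound (a b c₁ c₂ c₃ : ℝ) (hb : 1 < b) (hc₁ : 0 < c₁) (hc₃ : 0 < c₃) :
    ∃ c : ℝ, 0 < c ∧
      ∀ (d : ℕ) (V : Matrix (Fin d) (Fin d) ℝ) (lam : Fin d → ℝ) (σ : ℝ) (T : ℕ),
        V ∈ Matrix.orthogonalGroup (Fin d) ℝ → Antitone lam →
        PowerLawSpectrum lam a c₁ c₂ → 0 < σ → 1 ≤ T → σ ^ 2 ≤ T →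
        ((T : ℝ) / σ ^ 2) ^ (1 / b) ≤ d →
        ENNReal.ofReal (c * ((T : ℝ) ^ (-1 + 1 / b) * σ ^ (2 - 2 / b)))
          ≤ minimaxRisk (sourceClass V lam b c₃ σ) T := by
  -- The cap `c₃` serves the source condition and `1/2` the Bernoulli inequality below.
  set ρ := min c₃ (1 / 2) with hρ
  have hρ0 : 0 < ρ := lt_min hc₃ (by norm_num)
  have hρ1 : ρ ≤ c₃ := min_le_left _ _
  have hρ2 : ρ ≤ 1 / 2 := min_le_right _ _
  refine ⟨ρ / 8, by positivity, ?_⟩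
  intro d V lam σ T hV ha hpow hσ hT hσT hd
  have hT1 : (1 : ℝ) ≤ T := by exact_mod_cast hT
  have hTpos : (0 : ℝ) < T := by linarith
  have hlam : ∀ i, 0 < lam i := fun i => lt_of_lt_of_le (by positivity) (hpow i).1
  set Z := ((T : ℝ) / σ ^ 2) ^ (1 / b) with hZ
  have hZ1 : 1 ≤ Z := Real.one_le_rpow (by rw [le_div_iff₀ (by positivity)]; linarith)
    (by positivity)
  set m := ⌊Z⌋₊ with hm
  have hmZ : (m : ℝ) ≤ Z := Nat.floor_le (by linarith)
  have hm2 : Z / 2 ≤ m := by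
    have h1 := Nat.lt_floor_add_one Z
    have h2 : (1 : ℝ) ≤ m := by exact_mod_cast Nat.le_floor (by simpa using hZ1)
    linarith
  have hmd : m ≤ d := by exact_mod_cast hmZ.trans hd
  set S : Finset (Fin d) := Finset.univ.filter fun i => (i : ℕ) < m with hS
  have hcard : S.card = m := by
    rw [hS, Fin.card_filter_val_lt, min_eq_right hmd]
  set ε := √(ρ / T) with hε
  have hε2 : ε ^ 2 = ρ / T := Real.sq_sqrt (by positivity)
  have hε1 : ε ^ 2 ≤ 1 / 2 := by
    rw [hε2, div_le_iff₀ hTpos]; linarith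
  have hκ : 1 / 2 ≤ (1 - ε ^ 2) ^ T := by
    -- Bernoulli: `(1 - ε²)^T ≥ 1 - Tε² = 1 - ρ`.
    have h := one_add_mul_le_pow (a := -ε ^ 2) (by linarith) T
    have h2 : (T : ℝ) * ε ^ 2 = ρ := by rw [hε2]; field_simp
    rw [← sub_eq_add_neg] at h
    refine le_trans ?_ h
    linarith
  refine le_trans (ENNReal.ofReal_le_ofReal ?_)
    (le_minimaxRisk_of_cube (T := T) (σ := σ) (ε := ε) hV ha hlam S (by linarith) _ ?_)
  · rw [hcard]
    have e1 : (T : ℝ) ^ (-1 + 1 / b) * σ ^ (2 - 2 / b) = Z * (σ ^ 2 / T) := by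
      rw [hZ, Real.div_rpow hTpos.le (by positivity), Real.rpow_add hTpos, Real.rpow_neg_one,
        Real.rpow_sub hσ, ← Real.rpow_natCast σ 2, ← Real.rpow_mul hσ.le]
      push_cast
      rw [show (2 : ℝ) * (1 / b) = 2 / b by ring]
      field_simp
    rw [e1]
    calc ρ / 8 * (Z * (σ ^ 2 / T)) = 1 / 2 * (Z / 2 * ((σ ^ 2 * (ρ / T)) * (1 / 2))) := by ring
      _ ≤ 1 / 2 * (m * ((σ ^ 2 * (ρ / T)) * (1 - ε ^ 2) ^ T)) := by gcongr
      _ = _ := by rw [mul_pow, hε2]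
  · intro r he
    refine ⟨isEigensystem_signProblem he hlam hV ha, ⟨signMinimizer V lam σ (cubeMean S ε r),
      objective_signMinimizer_le he hlam hV ha, fun i => ?_⟩,
      noiseBoundedBy_signProblem he hlam hV ha⟩
    rw [transpose_mulVec_signMinimizer hV, div_pow, Real.sq_sqrt (hlam i).le,
      mul_div_cancel₀ _ (hlam i).ne', mul_pow]
    by_cases hi : i ∈ S
    · have him : (i : ℝ) + 1 ≤ Z := by
        have : (i : ℕ) + 1 ≤ m := (Finset.mem_filter.1 hi).2
        have : ((i : ℕ) : ℝ) + 1 ≤ m := by exact_mod_cast this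
        linarith
      have h1 : Z ^ (-b) ≤ ((i : ℝ) + 1) ^ (-b) :=
        Real.rpow_le_rpow_of_nonpos (by positivity) him (by linarith)
      have h2 : Z ^ (-b) = σ ^ 2 / T := by
        rw [hZ, ← Real.rpow_mul (by positivity), show 1 / b * -b = -1 by field_simp,
          Real.rpow_neg_one, inv_div]
      calc σ ^ 2 * cubeMean S ε r i ^ 2 ≤ σ ^ 2 * ε ^ 2 := by
            exact mul_le_mul_of_nonneg_left (cubeMean_sq_le S ε r i) (sq_nonneg _)
        _ = ρ * (σ ^ 2 / T) := by rw [hε2]; ring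
        _ ≤ c₃ * ((i : ℝ) + 1) ^ (-b) := by rw [← h2]; gcongr
    · simp only [cubeMean, hi, if_false]
      have : 0 ≤ c₃ * ((i : ℝ) + 1) ^ (-b) := by positivity
      simpa using this

end Minimax

end HeavyBall

end

theorem mainTheorem3 (a b c₁ c₂ c₃ : ℝ) (ha : 1 < a) (hb : 1 < b)
    (hc₁ : 0 < c₁) (hc₂ : 0 < c₂) (hc₃ : 0 < c₃) :
    (b < a → a ≤ 2 * b → ∃ C : ℝ, 0 < C ∧
      ∀ (d : ℕ) [NeZero d] (P : HeavyBall.Problem d) (V : Matrix (Fin d) (Fin d) ℝ)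
        (lam : Fin d → ℝ) (σ : ℝ) (T : ℕ) (β η₀ : ℝ)
        (Ω : Type*) [MeasurableSpace Ω] (μ : Measure Ω) [IsProbabilityMeasure μ]
        (ξ : ℕ → Ω → HeavyBall.Obs d),
        P.IsEigensystem V lam → HeavyBall.PowerLawSpectrum lam a c₁ c₂ →
        P.SourceCondition V lam b c₃ → 0 ≤ σ → 16 ≤ T →
        HeavyBall.momentumConst T * (T : ℝ) ^ (-((a - b) / b)) ≤ 1 →
        β = (1 - HeavyBall.momentumConst T * (T : ℝ) ^ (-((a - b) / b))) ^ 2 →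
        η₀ = (2 * lam 0)⁻¹ →
        HeavyBall.IsSample P μ ξ → HeavyBall.RunNoiseBoundedBy P μ ξ β η₀ T σ →
        HeavyBall.ExpectedExcessLE P μ ξ β η₀ T
          (C * (Real.logb 2 T ^ 6 * (T : ℝ) ^ (-1 + 1 / b)
            + σ ^ 2 * Real.logb 2 T ^ 8 * (T : ℝ) ^ (-1 + 1 / b)))) ∧
    (a ≤ b → ∃ C : ℝ, 0 < C ∧
      ∀ (d : ℕ) [NeZero d] (P : HeavyBall.Problem d) (V : Matrix (Fin d) (Fin d) ℝ)
        (lam : Fin d → ℝ) (σ : ℝ) (T : ℕ) (η₀ : ℝ)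
        (Ω : Type*) [MeasurableSpace Ω] (μ : Measure Ω) [IsProbabilityMeasure μ]
        (ξ : ℕ → Ω → HeavyBall.Obs d),
        P.IsEigensystem V lam → HeavyBall.PowerLawSpectrum lam a c₁ c₂ →
        P.SourceCondition V lam b c₃ → 0 ≤ σ → 16 ≤ T →
        η₀ = 1 / (2 * lam 0) * (T : ℝ) ^ (-1 + a / b) →
        HeavyBall.IsSample P μ ξ → HeavyBall.RunNoiseBoundedBy P μ ξ 0 η₀ T σ →
        HeavyBall.ExpectedExcessLE P μ ξ 0 η₀ T
          (C * (Real.logb 2 T ^ (2 * (b - 1) / a) * (T : ℝ) ^ (-1 + 1 / b)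
            + σ ^ 2 * Real.logb 2 T ^ 4 * (T : ℝ) ^ (-1 + 1 / b)))) ∧
    (∃ c : ℝ, 0 < c ∧
      ∀ (d : ℕ) (V : Matrix (Fin d) (Fin d) ℝ) (lam : Fin d → ℝ) (σ : ℝ) (T : ℕ),
        V ∈ Matrix.orthogonalGroup (Fin d) ℝ → Antitone lam →
        HeavyBall.PowerLawSpectrum lam a c₁ c₂ → 0 < σ → 1 ≤ T → σ ^ 2 ≤ T →
        ((T : ℝ) / σ ^ 2) ^ (1 / b) ≤ d →
        ENNReal.ofReal (c * ((T : ℝ) ^ (-1 + 1 / b) * σ ^ (2 - 2 / b)))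
          ≤ HeavyBall.minimaxRisk (HeavyBall.sourceClass V lam b c₃ σ) T) :=
  ⟨HeavyBall.heavyBall_upper_bound a b c₁ c₂ c₃ ha hb hc₁ hc₂ hc₃,
    HeavyBall.sgd_upper_bound a b c₁ c₂ c₃ ha hb hc₁ hc₂ hc₃,
    HeavyBall.minimax_lower_bound a b c₁ c₂ c₃ hb hc₁ hc₃⟩
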